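/- For a sign $\epsilon\in\{+,-\}$ and $n\ge 0$, a signed $n$-partition (resp. signed $n$-half-partition) is a vector $\lambda_\epsilon=(\lambda_1,\dots,\lambda_{n-1},\epsilon\lambda_n)$ with $\lambda_1\ge\dots\ge\lambda_n\ge 0$ all in $\mathbb Z$ (resp. all in $\frac12+\mathbb Z$); it is unsigned if $\epsilon=+$. An orthogonal pattern of height $N$ is an array $z=(z_{i,j})_{1\le i\le N,\ 1\le j\le\lceil i/2\rceil}$ with entries all in $\mathbb Z$ or all in $\frac12+\mathbb Z$, such that all entries other than the $z_{2i-1,i}$ are non-negative and $|z_{i+1,j+1}|\le|z_{i,j}|\le|z_{i+1,j}|$ whenever these entries exist. Its shape is its bottom row, and its type is given by $\mathrm{type}(z)_i=\sum_{j\le\lceil i/2\rceil}|z_{i,j}|-\sum_{j\le\lceil (i-1)/2\rceil}|z_{i-1,j}|$. With $\mathrm{sign}(a)=+1$ for $a\ge 0$ and $\mathrm{sign}(a)=-1$ for $a<0$, put $$w_z(x)=x_1^{z_{1,1}}\prod_{i=2}^n x_i^{\mathrm{sign}(z_{2i-3,i-1})\,\mathrm{sign}(z_{2i-1,i})\,[\mathrm{type}(z)_{2i-1}-\mathrm{type}(z)_{2i-2}]},\qquad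 x=(x_1,\dots,x_n).$$ The even orthogonal character $\mathrm{so}^{(2n)}_{\lambda_\epsilon}(x)$, for a signed $n$-partition or signed $n$-half-partition $\lambda_\epsilon$, is $\sum_z w_z(x)$ over all orthogonal patterns $z$ of height $2n-1$ and shape $\lambda_\epsilon$. The odd orthogonal character $\mathrm{so}^{(2n+1)}_{\lambda}(x)$, for an $n$-partition or $n$-half-partition $\lambda$, is $\sum_z w_z(x)$ over all orthogonal patterns $z$ of height $2n$ and shape $\lambda$. Both are Laurent polynomials in $x_1^{1/2},\dots,x_n^{1/2}$, equal to $1$ for $n=0$. Write $u^{(k)}=(u,\dots,u)$ ($k$ entries) and $u^{(k)}_\epsilon=(u,\dots,u,\epsilon u)$. A sum over $\lambda_\delta\subseteq u^{(m)}$ runs over all signed $m$-partitions (if $u\in\mathbb Z$) or signed $m$-half-partitions (if $u\in\frac12+\mathbb Z$) $\lambda_\delta=(\lambda_1,\dots,\lambda_{m-1},\delta\lambda_m)$ with $\lambda_1\le u$, each vector being counted once (so $\lambda_+=\lambda_-$ gives a single term when $\lambda_m=0$). **Theorem.** Let $u\in\frac12\mathbb Z_{\ge 0}$, let $n,m\ge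 0$ be integers, and let $x=(x_1,\dots,x_n)$, $y=(y_1,\dots,y_m)$ be variables. If $n\ge m$ and $\epsilon$ is a sign (with $\epsilon=+$ if $m=0$), then $$\mathrm{so}^{(2n+2m)}_{u^{(n+m)}_{\epsilon}}(x,y)=\sum_{\lambda_\delta\subseteq u^{(m)}}\mathrm{so}^{(2n)}_{(u^{(n-m)},\lambda_\delta)}(x)\cdot\mathrm{so}^{(2m)}_{\lambda_{\delta\epsilon}}(y).$$ If $n+1\ge m$, then $$\mathrm{so}^{(2n+2m+1)}_{u^{(n+m)}}(x,y)=\sum_{\lambda_\delta\subseteq u^{(m)}}\mathrm{so}^{(2n+2)}_{(u^{(n+1-m)},\lambda_\delta)}(x,1)\cdot\mathrm{so}^{(2m)}_{\lambda_\delta}(y),$$ where $1^{1/2}=1$. These are identities of Laurent polynomials in the $x_i^{1/2}$ and $y_j^{1/2}$; equivalently, they hold in every commutative ring for all $x_i,y_j$ with chosen invertible square roots $x_i^{1/2},y_j^{1/2}$. -/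

import Mathlib

/-!
Conventions. All numbers in `½ℤ` (entries of patterns, parts of (half-)partitions, exponents) are
stored doubled: the integer `a` stands for `a / 2`. So even integers stand for integers and odd
integers for half-integers. Accordingly the variables `x i` are given through square roots `r i`,
units of a commutative ring with `x i = (r i) ^ 2`, and the monomial `x i ^ (a / 2)` is `r i ^ a`.
A Laurent polynomial identity in the `x i ^ (1 / 2)` is the same as the identity for all such `r`.
-/

namespace OrthogonalCharacters

/-- The sign of an integer, with the convention that the sign of `0` is `+1`. -/
def sgn (a : ℤ) : ℤ := if 0 ≤ a then 1 else -1

/-- `(i, j)` is a position of the half-triangular array of height `N`: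
`1 ≤ i ≤ N` and `1 ≤ j ≤ ⌈i / 2⌉`. -/
def IsPosition (N i j : ℕ) : Prop := 1 ≤ i ∧ i ≤ N ∧ 1 ≤ j ∧ j ≤ (i + 1) / 2

/-- Orthogonal patterns of height `N`: half-triangular arrays `z i j` (indexed from `1`, extended by
zero outside the array) of integers or of half-integers, in which only the odd ends
`z (2 * p - 1) p` may be negative, and which interlace in absolute value. -/
structure IsOrthogonalPattern (N : ℕ) (z : ℕ → ℕ → ℤ) : Prop where
  zero_outside : ∀ i j, ¬ IsPosition N i j → z i j = 0
  integral : (∀ i j, IsPosition N i j → Even (z i j)) ∨ (∀ i j, IsPosition N i j → Odd (z i j))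
  nonneg : ∀ i j, IsPosition N i j → i ≠ 2 * j - 1 → 0 ≤ z i j
  le_below : ∀ i j, IsPosition N i j → IsPosition N (i + 1) j → |z i j| ≤ |z (i + 1) j|
  below_le : ∀ i j, IsPosition N i j → IsPosition N (i + 1) (j + 1) →
    |z (i + 1) (j + 1)| ≤ |z i j|

/-- The orthogonal patterns of height `N` whose bottom row is `lam`
(used with `lam` of length `n = ⌈N / 2⌉`). -/
def orthogonalPatterns (N : ℕ) {n : ℕ} (lam : Fin n → ℤ) : Set (ℕ → ℕ → ℤ) :=
  {z | IsOrthogonalPattern N z ∧ ∀ j : Fin n, z N (j + 1) = lam j}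

theorem orthogonalPatterns_finite (N : ℕ) {n : ℕ} (hN : (N + 1) / 2 ≤ n) (lam : Fin n → ℤ) :
    (orthogonalPatterns N lam).Finite := by
  have key : ∀ z ∈ orthogonalPatterns N lam, ∀ d i j, i + d = N → IsPosition N i j →
      |z i j| ≤ ∑ l, |lam l| := by
    rintro z ⟨hz, hs⟩ d
    induction d with
    | zero =>
      intro i j hi hp
      have hp' := hp
      obtain ⟨h1, h2, h3, h4⟩ := hp'
      have hiN : i = N := by omega
      subst hiN
      have hj : j - 1 < n := by omega
      have h := hs ⟨j - 1, hj⟩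
      have hj' : j - 1 + 1 = j := by omega
      simp only [hj'] at h
      rw [h]
      exact Finset.single_le_sum (f := fun l => |lam l|) (fun l _ => abs_nonneg _)
        (Finset.mem_univ (⟨j - 1, hj⟩ : Fin n))
    | succ d ih =>
      intro i j hi hp
      have hp' : IsPosition N (i + 1) j := by
        obtain ⟨h1, h2, h3, h4⟩ := hp
        exact ⟨by omega, by omega, h3, by omega⟩
      exact (hz.le_below i j hp hp').trans (ih (i + 1) j (by omega) hp')
  let B : ℤ := ∑ l, |lam l|
  let ι := Fin (N + 1) × Fin (N + 1)
  have hfin : (Set.pi Set.univ (fun _ : ι => Set.Icc (-B) B)).Finite :=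
    Set.Finite.pi' (fun _ => Set.finite_Icc _ _) |>.subset (fun f hf i => hf i (Set.mem_univ i))
  refine Set.Finite.of_finite_image (f := fun z (p : ι) => z p.1 p.2) (hfin.subset ?_) ?_
  · rintro _ ⟨z, hz, rfl⟩ p -
    by_cases hp : IsPosition N p.1 p.2
    · exact abs_le.mp (key z hz (N - p.1) p.1 p.2 (by have := hp.2.1; omega) hp)
    · have hB : 0 ≤ B := Finset.sum_nonneg (fun _ _ => abs_nonneg _)
      simp only [hz.1.zero_outside _ _ hp, Set.mem_Icc]
      constructor <;> omega
  · intro z hz w hw h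
    funext i j
    by_cases hp : IsPosition N i j
    · obtain ⟨h1, h2, h3, h4⟩ := hp
      exact congrFun h (⟨i, by omega⟩, ⟨j, by omega⟩)
    · rw [hz.1.zero_outside _ _ hp, hw.1.zero_outside _ _ hp]

/-- The `i`-th component of the type of a pattern:
`∑_{j ≤ ⌈i / 2⌉} |z i j| - ∑_{j ≤ ⌈(i - 1) / 2⌉} |z (i - 1) j|`. -/
noncomputable def patternType (z : ℕ → ℕ → ℤ) (i : ℕ) : ℤ :=
  ∑ j ∈ Finset.Icc 1 ((i + 1) / 2), |z i j| - ∑ j ∈ Finset.Icc 1 (i / 2), |z (i - 1) j|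

/-- The exponent of the `i`-th variable (`i ≥ 1`) in the weight monomial of a pattern. -/
noncomputable def weightExponent (z : ℕ → ℕ → ℤ) (i : ℕ) : ℤ :=
  if i = 1 then z 1 1
  else sgn (z (2 * i - 3) (i - 1)) * sgn (z (2 * i - 1) i) *
    (patternType z (2 * i - 1) - patternType z (2 * i - 2))

variable {R : Type*} [CommRing R]

/-- The weight monomial `∏ i, x i ^ (weightExponent z i)`, in terms of square roots `r` of the
variables; the variable `x_{i + 1}` of the usual numbering has index `i : Fin n`. -/
noncomputable def patternWeight {n : ℕ} (r : Fin n → Rˣ) (z : ℕ → ℕ → ℤ) : R :=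
  ((∏ i : Fin n, r i ^ weightExponent z (i + 1) : Rˣ) : R)

/-- The `(2n)`-orthogonal Schur polynomial (the character of `SO_{2n}`) indexed by a signed
`n`-(half-)partition, as generating function of orthogonal patterns of height `2n - 1`. -/
noncomputable def soEven {n : ℕ} (lam : Fin n → ℤ) (r : Fin n → Rˣ) : R :=
  ∑ z ∈ (orthogonalPatterns_finite (2 * n - 1) (by omega) lam).toFinset, patternWeight r z

/-- The `(2n + 1)`-orthogonal Schur polynomial (the character of `SO_{2n + 1}`) indexed by an
`n`-(half-)partition, as generating function of orthogonal patterns of height `2n`. -/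
noncomputable def soOdd {n : ℕ} (lam : Fin n → ℤ) (r : Fin n → Rˣ) : R :=
  ∑ z ∈ (orthogonalPatterns_finite (2 * n) (by omega) lam).toFinset, patternWeight r z

/-- The finite set of the signed `m`-(half-)partitions `lam_δ ⊆ u^(m)`, where `u = k / 2`: vectors
`(lam_1, …, lam_{m-1}, δ lam_m)` with `u ≥ lam_1 ≥ ⋯ ≥ lam_m ≥ 0`, whose entries are all integers or
all half-integers according to which of the two `u` is. The vector is counted once if
`lam_m = 0`. -/
noncomputable def signedPartitionsIn (m k : ℕ) : Finset (Fin m → ℤ) :=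
  (Fintype.piFinset fun _ : Fin m => Finset.Icc (-(k : ℤ)) k).filter fun lam =>
    (∀ i, Even (lam i - k)) ∧ ∀ i j, i < j → |lam j| ≤ lam i

/-- The rectangular (half-)partition `u^(n) = (u, …, u)`, where `u = k / 2`. -/
def rect (k n : ℕ) : Fin n → ℤ := fun _ => k

/-- The vector `lam` with its last entry multiplied by the sign `ε`. -/
def withSign {n : ℕ} (ε : ℤˣ) (lam : Fin n → ℤ) : Fin n → ℤ :=
  fun i => if (i : ℕ) + 1 = n then ε * lam i else lam i

/-- The vector `(u^(n - m), lam)` of length `n`, where `u = k / 2` and `lam` has length `m ≤ n`. -/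
def rectAppend (k n : ℕ) {m : ℕ} (lam : Fin m → ℤ) : Fin n → ℤ :=
  fun i => if h : n - m ≤ (i : ℕ) then lam ⟨i - (n - m), by omega⟩ else k

end OrthogonalCharacters

/-!
Deleting the last two rows of a pattern branches a character over its last variable: the character
of `lam` in the variables `(r, q)` is the sum over `nu` of `branch lam nu q` times the character of
`nu` in `r`. The branching coefficient is a sum over the partitions interlacing with both `|lam|`
and `|nu|`, so it is nearly symmetric in the two; in particular `branch (u, u, al) be` and
`branch be al` coincide. For `ε = +` this moves the last variable of the first character of each
product to the second character, while `lam` gains a part. Induction on the number of variables `y`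
then proves the identity, provided that `so_{(u, …, u)}` is symmetric in its variables, so that
any of them may be the last one.

That the even characters are symmetric is seen from the Weyl character formula: by branching and
telescoping sums, `2 * so_lam` times a Vandermonde determinant is the sum of two determinants which
are alternating in the variables. The factor may be cancelled in the ring of Laurent polynomials,
and the symmetry there specialises to every commutative ring.

The remaining cases reduce to this one. Changing the sign of the last part amounts to inverting the
last variable, and an odd character of rectangular shape is the even one with an additional
variable `1`.
-/

namespace OrthogonalCharacters

section ParityIntervals

/-- The integers in `[a, b]` of the same parity as `k`: in the doubled encoding, the integers or the
half-integers of an interval. -/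
noncomputable def parityIcc (k a b : ℤ) : Finset ℤ := (Finset.Icc a b).filter fun t => Even (t - k)

theorem mem_parityIcc {k a b t : ℤ} : t ∈ parityIcc k a b ↔ (a ≤ t ∧ t ≤ b) ∧ Even (t - k) := by
  simp [parityIcc]

theorem parityIcc_eq_image {k a : ℤ} (ha : Even (a - k)) (d : ℕ) :
    parityIcc k a (a + 2 * d - 2) = (Finset.range d).image fun i : ℕ => a + 2 * (i : ℤ) := by
  ext t
  simp only [mem_parityIcc, Finset.mem_image, Finset.mem_range]
  obtain ⟨x, hx⟩ := ha
  constructor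
  · rintro ⟨⟨hat, htb⟩, y, hy⟩
    exact ⟨(y - x).toNat, by omega, by omega⟩
  · rintro ⟨i, hi, rfl⟩
    exact ⟨⟨by omega, by omega⟩, x + i, by omega⟩

variable {M : Type*}

theorem sum_parityIcc_telescope [AddCommGroup M] (G : ℤ → M) {k a b : ℤ}
    (ha : Even (a - k)) (hb : Even (b - k)) (hab : a ≤ b + 2) :
    ∑ t ∈ parityIcc k a b, (G (t + 2) - G t) = G (b + 2) - G a := by
  obtain ⟨d, rfl⟩ : ∃ d : ℕ, b = a + 2 * d - 2 := by
    obtain ⟨⟨x, hx⟩, y, hy⟩ := And.intro ha hb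
    exact ⟨(y - x + 1).toNat, by omega⟩
  rw [parityIcc_eq_image ha, Finset.sum_image fun i _ j _ hij => by simpa using hij]
  simpa [mul_add, add_assoc] using Finset.sum_range_sub (fun i : ℕ => G (a + 2 * (i : ℤ))) d

theorem sum_parityIcc_split [AddCommMonoid M] (f : ℤ → M) {k a b c : ℤ} (hc : Even (c - k))
    (hac : a ≤ c) (hcb : c ≤ b + 2) :
    ∑ t ∈ parityIcc k a b, f t = ∑ t ∈ parityIcc k a (c - 2), f t + ∑ t ∈ parityIcc k c b, f t := by
  rw [← Finset.sum_union]
  · congr 1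
    ext t
    simp only [mem_parityIcc, Finset.mem_union]
    grind
  · rw [Finset.disjoint_left]
    simp only [mem_parityIcc]
    omega

theorem sum_parityIcc_neg [AddCommMonoid M] (f : ℤ → M) (k a b : ℤ) :
    ∑ t ∈ parityIcc k (-b) (-a), f t = ∑ t ∈ parityIcc k a b, f (-t) := by
  have neg_mem : ∀ {x y t : ℤ}, t ∈ parityIcc k x y → -t ∈ parityIcc k (-y) (-x) := by
    intro x y t ht
    simp only [mem_parityIcc] at ht ⊢
    grind
  refine Finset.sum_bij' (fun t _ => -t) (fun t _ => -t) (fun t ht => ?_) (fun t ht => neg_mem ht)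
    (by simp) (by simp) (by simp)
  simpa using neg_mem ht

theorem sum_parityBox_reflect [AddCommMonoid M] {ι : Type*} [Fintype ι] [DecidableEq ι] {k : ℤ}
    {a b : ι → ℤ} (hab : ∀ j, Even (a j + b j)) (f : ℤ → M) :
    ∑ mu ∈ Fintype.piFinset fun j => parityIcc k (a j) (b j), f (∑ j, mu j) =
      ∑ mu ∈ Fintype.piFinset fun j => parityIcc k (a j) (b j),
        f (∑ j, (a j + b j) - ∑ j, mu j) := by
  have reflect_mem : ∀ mu ∈ Fintype.piFinset fun j => parityIcc k (a j) (b j),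
      (fun j => a j + b j - mu j) ∈ Fintype.piFinset fun j => parityIcc k (a j) (b j) := by
    intro mu hmu
    simp only [Fintype.mem_piFinset, mem_parityIcc] at hmu ⊢
    grind
  refine Finset.sum_bij' (fun mu _ j => a j + b j - mu j) (fun mu _ j => a j + b j - mu j)
    reflect_mem reflect_mem ?_ ?_ ?_
  · simp
  · simp
  · intro mu _
    congr 1
    simp [Finset.sum_sub_distrib]

end ParityIntervals

section SignedPartitions

theorem mem_signedPartitionsIn {m k : ℕ} {lam : Fin m → ℤ} :
    lam ∈ signedPartitionsIn m k ↔
      (∀ i, |lam i| ≤ k) ∧ (∀ i, Even (lam i - k)) ∧ ∀ i j, i < j → |lam j| ≤ lam i := by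
  simp [signedPartitionsIn, abs_le]

theorem abs_castSucc_of_mem_signedPartitionsIn {n k : ℕ} {lam : Fin (n + 1) → ℤ}
    (h : lam ∈ signedPartitionsIn (n + 1) k) (j : Fin n) : |lam j.castSucc| = lam j.castSucc :=
  abs_of_nonneg <| (abs_nonneg _).trans <|
    (mem_signedPartitionsIn.1 h).2.2 j.castSucc j.succ Fin.castSucc_lt_succ

theorem rect_mem_signedPartitionsIn (k n : ℕ) : rect k n ∈ signedPartitionsIn n k := by
  simp [mem_signedPartitionsIn, rect]

theorem sgn_mul_abs (a : ℤ) : sgn a * |a| = a := by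
  unfold sgn
  grind

theorem sgn_neg {a : ℤ} (h : a ≠ 0) : sgn (-a) = -sgn a := by
  unfold sgn
  grind

theorem abs_add_eq_of_sgn (a b : ℤ) :
    sgn a * sgn b = 1 ∧ |b + a| = |b| + |a| ∨
      sgn a * sgn b = -1 ∧ |b + a| = |b| + |a| - 2 * min |a| |b| := by
  unfold sgn
  grind

theorem abs_cons (a : ℤ) {n : ℕ} (nu : Fin n → ℤ) :
    |(Fin.cons a nu : Fin (n + 1) → ℤ)| = Fin.cons |a| |nu| :=
  Fin.comp_cons abs a nu

theorem even_abs_sub {a k : ℤ} (h : Even (a - k)) : Even (|a| - k) := by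
  grind

theorem withSign_one {n : ℕ} (lam : Fin n → ℤ) : withSign 1 lam = lam := by
  funext i
  simp [withSign]

theorem withSign_castSucc {n : ℕ} (ε : ℤˣ) (lam : Fin (n + 1) → ℤ) (i : Fin n) :
    withSign ε lam i.castSucc = lam i.castSucc :=
  if_neg (by simpa using i.isLt.ne)

theorem withSign_last {n : ℕ} (ε : ℤˣ) (lam : Fin (n + 1) → ℤ) :
    withSign ε lam (Fin.last n) = ε * lam (Fin.last n) := by
  simp [withSign]

theorem abs_withSign {n : ℕ} (ε : ℤˣ) (lam : Fin n → ℤ) (i : Fin n) :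
    |withSign ε lam i| = |lam i| := by
  rcases Int.units_eq_one_or ε with rfl | rfl <;> simp [withSign, apply_ite abs]

theorem withSign_mem_signedPartitionsIn {n k : ℕ} (ε : ℤˣ) {lam : Fin n → ℤ}
    (h : lam ∈ signedPartitionsIn n k) : withSign ε lam ∈ signedPartitionsIn n k := by
  rw [mem_signedPartitionsIn] at h ⊢
  obtain ⟨hbound, hparity, hdecr⟩ := h
  refine ⟨fun i => by rw [abs_withSign]; exact hbound i, fun i => ?_, fun i j hij => ?_⟩
  · have := hparity i
    rcases Int.units_eq_one_or ε with rfl | rfl <;> simp [withSign] <;> grind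
  · rw [abs_withSign, withSign, if_neg (by omega)]
    exact hdecr i j hij

/-- The sign of the last entry of a vector, with the value `1` for the empty vector; it is the sign
carried by an odd row of a pattern. -/
def lastSgn : {n : ℕ} → (Fin n → ℤ) → ℤ
  | 0, _ => 1
  | n + 1, nu => sgn (nu (Fin.last n))

theorem lastSgn_cons {a : ℤ} (ha : 0 ≤ a) {n : ℕ} (nu : Fin n → ℤ) :
    lastSgn (Fin.cons a nu : Fin (n + 1) → ℤ) = lastSgn nu := by
  cases n with
  | zero => simp [lastSgn, sgn, ha]
  | succ n => simp only [lastSgn, ← Fin.succ_last, Fin.cons_succ]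

end SignedPartitions

section Interlacing

variable {k : ℤ} {n : ℕ} {A B : Fin (n + 1) → ℤ}

/-- The rows `mu`, of the parity of `k`, that interlace with both `A` and `B`:
`A (j + 1) ≤ mu j ≤ A j` and `B (j + 1) ≤ mu j ≤ B j`. -/
noncomputable def interlacers (k : ℤ) {n : ℕ} (A B : Fin (n + 1) → ℤ) : Finset (Fin n → ℤ) :=
  Fintype.piFinset fun j =>
    parityIcc k (max (A j.succ) (B j.succ)) (min (A j.castSucc) (B j.castSucc))

theorem mem_interlacers {mu : Fin n → ℤ} :
    mu ∈ interlacers k A B ↔ ∀ j, ((A j.succ ≤ mu j ∧ B j.succ ≤ mu j) ∧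
      mu j ≤ A j.castSucc ∧ mu j ≤ B j.castSucc) ∧ Even (mu j - k) := by
  simp only [interlacers, Fintype.mem_piFinset, mem_parityIcc, max_le_iff, le_min_iff]

theorem interlacers_comm (k : ℤ) (A B : Fin (n + 1) → ℤ) :
    interlacers k A B = interlacers k B A := by
  simp only [interlacers, max_comm, min_comm]

theorem sum_interlacing_bounds (A B : Fin (n + 1) → ℤ) :
    ∑ j : Fin n, (max (A j.succ) (B j.succ) + min (A j.castSucc) (B j.castSucc)) =
      ∑ i, A i + ∑ i, B i - max (A 0) (B 0) - min (A (Fin.last n)) (B (Fin.last n)) := by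
  have hmax := Fin.sum_univ_succ fun i => max (A i) (B i)
  have hmin := Fin.sum_univ_castSucc fun i => min (A i) (B i)
  have htotal : ∑ i, max (A i) (B i) + ∑ i, min (A i) (B i) = ∑ i, A i + ∑ i, B i := by
    simp only [← Finset.sum_add_distrib, max_add_min]
  rw [Finset.sum_add_distrib]
  linarith

theorem sum_interlacers_cons {M : Type*} [AddCommMonoid M] (hmax : max (A 0) (B 0) = k)
    (f : (Fin (n + 1) → ℤ) → M) :
    ∑ mu ∈ interlacers k (Fin.cons k A : Fin (n + 2) → ℤ) (Fin.cons k B : Fin (n + 2) → ℤ), f mu =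
      ∑ mu ∈ interlacers k A B, f (Fin.cons k mu) := by
  have cons_mem : ∀ mu, mu ∈ interlacers k (Fin.cons k A : Fin (n + 2) → ℤ)
      (Fin.cons k B : Fin (n + 2) → ℤ) ↔ mu 0 = k ∧ Fin.tail mu ∈ interlacers k A B := by
    intro mu
    simp only [mem_interlacers, Fin.forall_fin_succ, Fin.tail, Fin.castSucc_zero, Fin.cons_zero,
      Fin.cons_succ, ← Fin.succ_castSucc]
    grind
  refine Finset.sum_bij' (fun mu _ => Fin.tail mu)
    (fun mu _ => (Fin.cons k mu : Fin (n + 1) → ℤ)) (fun mu hmu => ((cons_mem mu).1 hmu).2)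
    (fun mu hmu => (cons_mem _).2 ⟨by simp, by simpa using hmu⟩) (fun mu hmu => ?_) (by simp)
    (fun mu hmu => ?_)
  all_goals rw [← ((cons_mem mu).1 hmu).1, Fin.cons_self_tail]

variable {R : Type*} [CommRing R]

/-- The generating function of the rows interlacing with `A` and `B`, up to the sign `σ` of the
exponent. It is the weight contributed by one even row of a pattern in the variable of its two
neighbours `A` and `B`, where the shorter neighbour is preceded by the bound `k` on all entries;
subtracting `k` from the exponent removes that extra entry. -/
noncomputable def interlaceSum (k σ : ℤ) {n : ℕ} (A B : Fin (n + 1) → ℤ) (q : Rˣ) : R :=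
  ∑ mu ∈ interlacers k A B, ((q ^ (σ * (∑ i, A i + ∑ i, B i - k - 2 * ∑ j, mu j)) : Rˣ) : R)

theorem interlaceSum_comm (k σ : ℤ) (A B : Fin (n + 1) → ℤ) (q : Rˣ) :
    interlaceSum k σ A B q = interlaceSum k σ B A q := by
  simp only [interlaceSum, interlacers_comm k A B, add_comm (∑ i, A i)]

theorem interlaceSum_neg (k σ : ℤ) (A B : Fin (n + 1) → ℤ) (q : Rˣ) :
    interlaceSum k (-σ) A B q = interlaceSum k σ A B q⁻¹ := by
  simp only [interlaceSum, inv_zpow', neg_mul]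

theorem interlaceSum_cons (hmax : max (A 0) (B 0) = k) (σ : ℤ) (q : Rˣ) :
    interlaceSum k σ (Fin.cons k A : Fin (n + 2) → ℤ) (Fin.cons k B : Fin (n + 2) → ℤ) q =
      interlaceSum k σ A B q := by
  simp only [interlaceSum, sum_interlacers_cons hmax, Fin.sum_cons]
  refine Finset.sum_congr rfl fun mu _ => ?_
  congr 3
  ring

theorem interlaceSum_reflect (hA : ∀ i, Even (A i - k)) (hB : ∀ i, Even (B i - k))
    (hmax : max (A 0) (B 0) = k) (σ : ℤ) (q : Rˣ) :
    interlaceSum k σ A B q = ∑ mu ∈ interlacers k A B,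
      ((q ^ (-σ * (∑ i, A i + ∑ i, B i - k - 2 * min (A (Fin.last n)) (B (Fin.last n))
        - 2 * ∑ j, mu j)) : Rˣ) : R) := by
  rw [interlaceSum, interlacers, sum_parityBox_reflect (fun j => ?_)
    fun t => ((q ^ (σ * (∑ i, A i + ∑ i, B i - k - 2 * t)) : Rˣ) : R)]
  · rw [sum_interlacing_bounds, hmax]
    refine Finset.sum_congr rfl fun mu _ => ?_
    congr 2
    ring
  · have := hA j.succ
    have := hB j.succ
    have := hA j.castSucc
    have := hB j.castSucc
    grind

end Interlacing

section Branching

variable {R : Type*} [CommRing R] {k n : ℕ}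

/-- The coefficient of the character of `nu` in the restriction of the character of `lam` from
`SO(2n + 2)` to `SO(2n)`, as a Laurent polynomial in the square root `q` of the last variable.
The parts of `lam` and `nu` are at most `k / 2`, and they are (half-)integers as `k / 2` is. -/
noncomputable def branch (k : ℕ) {n : ℕ} (lam : Fin (n + 1) → ℤ) (nu : Fin n → ℤ) (q : Rˣ) : R :=
  interlaceSum k (lastSgn lam * lastSgn nu) |lam| (Fin.cons (k : ℤ) |nu|) q

theorem branch_eq_sum_lastSgn (k : ℕ) (lam : Fin (n + 1) → ℤ) (nu : Fin n → ℤ) (q : Rˣ) :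
    (branch k lam nu q : R) = ∑ mu ∈ interlacers k |lam| (Fin.cons (k : ℤ) |nu|),
      ↑(q ^ (lastSgn lam * lastSgn nu * (∑ i, |lam i| + ∑ i, |nu i| - 2 * ∑ j, mu j))) := by
  simp only [branch, interlaceSum, Fin.sum_cons, Pi.abs_apply, ← add_assoc, add_sub_cancel_right,
    add_right_comm _ (k : ℤ)]

theorem branch_cons_cons {lam : Fin (n + 1) → ℤ} (hlam : |lam 0| ≤ k) (nu : Fin n → ℤ) (q : Rˣ) :
    (branch k (Fin.cons (k : ℤ) lam : Fin (n + 2) → ℤ) (Fin.cons (k : ℤ) nu : Fin (n + 1) → ℤ) q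
      : R) = branch k lam nu q := by
  have hk : (0 : ℤ) ≤ k := k.cast_nonneg
  simp only [branch, lastSgn_cons hk, abs_cons, abs_of_nonneg hk]
  exact interlaceSum_cons (by simpa using hlam) _ q

theorem branch_cons_cons_comm {be : Fin (n + 1) → ℤ} (hbe : |be 0| ≤ k) (al : Fin n → ℤ) (q : Rˣ) :
    (branch k (Fin.cons (k : ℤ) (Fin.cons (k : ℤ) al : Fin (n + 1) → ℤ) : Fin (n + 2) → ℤ) be q
      : R) = branch k be al q := by
  have hk : (0 : ℤ) ≤ k := k.cast_nonneg
  simp only [branch, lastSgn_cons hk, abs_cons, abs_of_nonneg hk, mul_comm (lastSgn al)]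
  rw [interlaceSum_cons (by simpa using hbe), interlaceSum_comm]

theorem branch_cons_cons_cons_eq_zero {nu : Fin (n + 2) → ℤ} (hnu : |nu 0| < k)
    (lam : Fin n → ℤ) (q : Rˣ) :
    (branch k (Fin.cons (k : ℤ) (Fin.cons (k : ℤ) (Fin.cons (k : ℤ) lam : Fin (n + 1) → ℤ) :
      Fin (n + 2) → ℤ) : Fin (n + 3) → ℤ) nu q : R) = 0 := by
  have hk : (0 : ℤ) ≤ k := k.cast_nonneg
  rw [branch, interlaceSum, Finset.sum_eq_zero fun mu hmu => ?_]
  have hrow := (mem_interlacers.1 hmu 1).1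
  simp only [abs_cons, abs_of_nonneg hk] at hrow
  exact absurd (hrow.1.1.trans hrow.2.2) (not_le.2 hnu)

theorem branch_reflect {lam : Fin (n + 1) → ℤ} {nu : Fin n → ℤ}
    (hlam : lam ∈ signedPartitionsIn (n + 1) k) (hnu : nu ∈ signedPartitionsIn n k) (q : Rˣ) :
    (branch k lam nu q : R) = ∑ mu ∈ interlacers k |lam| (Fin.cons (k : ℤ) |nu|),
      ↑(q ^ (-(lastSgn lam * lastSgn nu) * (∑ i, |lam i| + ∑ i, |nu i| -
        2 * min |lam (Fin.last n)| ((Fin.cons (k : ℤ) |nu| : Fin (n + 1) → ℤ) (Fin.last n)) -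
          2 * ∑ j, mu j))) := by
  rw [mem_signedPartitionsIn] at hlam hnu
  rw [branch, interlaceSum_reflect (A := |lam|) (fun i => even_abs_sub (hlam.2.1 i))
    (Fin.cases (by simp) fun i => by simpa using even_abs_sub (hnu.2.1 i))
    (by simpa using hlam.1 0)]
  simp only [Fin.sum_cons, Pi.abs_apply, ← add_assoc, add_sub_cancel_right,
    add_right_comm _ (k : ℤ)]

theorem branch_withSign_neg_one {lam : Fin (n + 1) → ℤ} {nu : Fin n → ℤ}
    (hlam : lam ∈ signedPartitionsIn (n + 1) k) (hnu : nu ∈ signedPartitionsIn n k) (q : Rˣ) :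
    (branch k (withSign (-1) lam) nu q : R) = branch k lam nu q⁻¹ := by
  by_cases hlast : lam (Fin.last n) = 0
  · have hneg : withSign (-1) lam = lam := by
      funext i
      refine Fin.lastCases ?_ (fun i => withSign_castSucc _ _ i) i
      rw [withSign_last, hlast, mul_zero]
    have hmin : min |lam (Fin.last n)| ((Fin.cons (k : ℤ) |nu| : Fin (n + 1) → ℤ) (Fin.last n)) =
        0 := by
      rw [hlast, abs_zero, min_eq_left]
      exact Fin.cases (by simp) (fun i => by simp) (Fin.last n)
    rw [hneg, branch_reflect hlam hnu, hmin, branch_eq_sum_lastSgn]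
    simp only [inv_zpow', neg_mul, mul_zero, sub_zero]
  · have hsgn : lastSgn (withSign (-1) lam) = -lastSgn lam := by
      simpa [lastSgn, withSign_last] using sgn_neg hlast
    have habs : |withSign (-1) lam| = |lam| := funext (abs_withSign (-1) lam)
    rw [branch, branch, hsgn, habs, neg_mul, interlaceSum_neg]

/-- Reflecting the sum over `mu` when the last entries have opposite signs makes the sign in the
exponent disappear. -/
theorem branch_eq_sum_abs_add {p : ℕ} {lam : Fin (p + 2) → ℤ} {nu : Fin (p + 1) → ℤ}
    (hlam : lam ∈ signedPartitionsIn (p + 2) k) (hnu : nu ∈ signedPartitionsIn (p + 1) k) (q : Rˣ) :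
    branch k lam nu q = ∑ mu ∈ interlacers k |lam| (Fin.cons (k : ℤ) |nu|),
      ((q ^ (∑ i : Fin (p + 1), lam i.castSucc + (∑ j : Fin p, nu j.castSucc +
        |nu (Fin.last p) + lam (Fin.last (p + 1))|) - 2 * ∑ j, mu j) : Rˣ) : R) := by
  have sum_abs_lam := Fin.sum_univ_castSucc fun i => |lam i|
  have sum_abs_nu := Fin.sum_univ_castSucc fun i => |nu i|
  simp only [abs_castSucc_of_mem_signedPartitionsIn hlam,
    abs_castSucc_of_mem_signedPartitionsIn hnu] at sum_abs_lam sum_abs_nu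
  rcases abs_add_eq_of_sgn (lam (Fin.last (p + 1))) (nu (Fin.last p)) with
    ⟨hsgn, habs⟩ | ⟨hsgn, habs⟩
  · rw [branch_eq_sum_lastSgn]
    refine Finset.sum_congr rfl fun mu _ => ?_
    simp only [lastSgn, hsgn, habs, sum_abs_lam, sum_abs_nu]
    congr 2
    ring
  · rw [branch_reflect hlam hnu, ← Fin.succ_last p, Fin.cons_succ, Fin.succ_last, Pi.abs_apply]
    refine Finset.sum_congr rfl fun mu _ => ?_
    simp only [lastSgn, hsgn, habs, sum_abs_lam, sum_abs_nu]
    congr 2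
    ring

end Branching

section AdjacentRows

/-- The even rows that interlace with the odd row `lam` below them. -/
noncomputable def evenRowsAbove (k : ℤ) {n : ℕ} (lam : Fin (n + 1) → ℤ) : Finset (Fin n → ℤ) :=
  Fintype.piFinset fun j => parityIcc k |lam j.succ| (lam j.castSucc)

/-- The odd rows that interlace with the even row `mu` below them. -/
noncomputable def oddRowsAbove (k : ℤ) {n : ℕ} (mu : Fin (n + 1) → ℤ) : Finset (Fin (n + 1) → ℤ) :=
  Fintype.piFinset fun j => parityIcc k
    ((Fin.snoc (fun j => mu j.succ) (-mu (Fin.last n)) : Fin (n + 1) → ℤ) j) (mu j)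

theorem mem_evenRowsAbove {k : ℤ} {n : ℕ} {lam : Fin (n + 1) → ℤ} {mu : Fin n → ℤ} :
    mu ∈ evenRowsAbove k lam ↔
      ∀ j, (|lam j.succ| ≤ mu j ∧ mu j ≤ lam j.castSucc) ∧ Even (mu j - k) := by
  simp only [evenRowsAbove, Fintype.mem_piFinset, mem_parityIcc]

theorem mem_oddRowsAbove {k : ℤ} {n : ℕ} {mu nu : Fin (n + 1) → ℤ} :
    nu ∈ oddRowsAbove k mu ↔ (∀ j, Even (nu j - k)) ∧
      (∀ j : Fin n, mu j.succ ≤ nu j.castSucc ∧ nu j.castSucc ≤ mu j.castSucc) ∧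
        |nu (Fin.last n)| ≤ mu (Fin.last n) := by
  simp only [oddRowsAbove, Fintype.mem_piFinset, mem_parityIcc, forall_and,
    Fin.forall_fin_succ' (n := n), Fin.snoc_castSucc, Fin.snoc_last, abs_le]
  tauto

theorem abs_le_of_forall_abs_succ_le {n : ℕ} {nu : Fin (n + 1) → ℤ}
    (h : ∀ j : Fin n, |nu j.succ| ≤ nu j.castSucc) {i j : Fin (n + 1)} (hij : i < j) :
    |nu j| ≤ nu i := by
  have hanti : Antitone fun i => |nu i| :=
    Fin.antitone_iff_succ_le.2 fun j => (h j).trans (le_abs_self _)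
  obtain ⟨i, rfl⟩ := Fin.exists_castSucc_eq.2 (hij.trans_le (Fin.le_last j)).ne
  exact (hanti (Fin.castSucc_lt_iff_succ_le.1 hij)).trans (h i)

theorem mem_signedPartitionsIn_and_mem_interlacers_iff {k p : ℕ} {lam : Fin (p + 2) → ℤ}
    (hlam : lam ∈ signedPartitionsIn (p + 2) k) {nu mu : Fin (p + 1) → ℤ} :
    nu ∈ signedPartitionsIn (p + 1) k ∧ mu ∈ interlacers k |lam| (Fin.cons (k : ℤ) |nu|) ↔
      nu ∈ oddRowsAbove k mu ∧ mu ∈ evenRowsAbove k lam := by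
  have hlam_abs := abs_castSucc_of_mem_signedPartitionsIn hlam
  have hlam_le := (mem_signedPartitionsIn.1 hlam).1
  simp only [mem_interlacers, mem_evenRowsAbove, mem_oddRowsAbove, Pi.abs_apply, hlam_abs,
    Fin.cons_succ]
  constructor
  · rintro ⟨hnu, hmu⟩
    have hnu_abs := abs_castSucc_of_mem_signedPartitionsIn hnu
    refine ⟨⟨(mem_signedPartitionsIn.1 hnu).2.1, fun j => ⟨?_, ?_⟩, (hmu _).1.1.2⟩,
      fun j => ⟨⟨(hmu j).1.1.1, (hmu j).1.2.1⟩, (hmu j).2⟩⟩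
    · simpa [← Fin.succ_castSucc, hnu_abs] using (hmu j.succ).1.2.2
    · exact (hnu_abs j).symm.trans_le (hmu j.castSucc).1.1.2
  · rintro ⟨⟨hparity, hbetween, hlast⟩, hmu⟩
    have mu_nonneg (j) : 0 ≤ mu j := (abs_nonneg _).trans (hmu j).1.1
    have nu_abs (j : Fin p) : |nu j.castSucc| = nu j.castSucc :=
      abs_of_nonneg ((mu_nonneg _).trans (hbetween j).1)
    have nu_le_mu (j) : |nu j| ≤ mu j := by
      cases j using Fin.lastCases with
      | last => exact hlast
      | cast j => exact (nu_abs j).trans_le (hbetween j).2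
    have mu_le (j) : mu j ≤ k := (hmu j).1.2.trans ((le_abs_self _).trans (hlam_le _))
    refine ⟨mem_signedPartitionsIn.2 ⟨fun j => (nu_le_mu j).trans (mu_le j), hparity, fun i j =>
      abs_le_of_forall_abs_succ_le fun j => (nu_le_mu _).trans (hbetween j).1⟩,
      fun j => ⟨⟨⟨(hmu j).1.1, nu_le_mu j⟩, (hmu j).1.2, ?_⟩, (hmu j).2⟩⟩
    cases j using Fin.cases with
    | zero => exact mu_le 0
    | succ j => simpa [← Fin.succ_castSucc, nu_abs] using (hbetween j).1

end AdjacentRows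

section Patterns

variable {k : ℤ} {N : ℕ} {z : ℕ → ℕ → ℤ}

/-- Orthogonal patterns whose entries have the parity of `k`. Fixing the parity makes the condition
on the entries local, so that a pattern can be built row by row. -/
structure IsParityPattern (k : ℤ) (N : ℕ) (z : ℕ → ℕ → ℤ) : Prop extends
    IsOrthogonalPattern N z where
  even_sub : ∀ i j, IsPosition N i j → Even (z i j - k)

/-- The sequence `v` may be put as row `N + 1` below the bottom row `u` of a pattern of height `N`
whose entries have the parity of `k`. -/
structure IsNextRow (k : ℤ) (N : ℕ) (u v : ℕ → ℤ) : Prop where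
  zero_outside : ∀ j, ¬ IsPosition (N + 1) (N + 1) j → v j = 0
  even_sub : ∀ j, IsPosition (N + 1) (N + 1) j → Even (v j - k)
  nonneg : ∀ j, IsPosition (N + 1) (N + 1) j → N + 1 ≠ 2 * j - 1 → 0 ≤ v j
  le_below : ∀ j, IsPosition N N j → |u j| ≤ |v j|
  below_le : ∀ j, IsPosition N N j → IsPosition (N + 1) (N + 1) (j + 1) → |v (j + 1)| ≤ |u j|

theorem integral_of_even_sub (h : ∀ i j, IsPosition N i j → Even (z i j - k)) :
    (∀ i j, IsPosition N i j → Even (z i j)) ∨ (∀ i j, IsPosition N i j → Odd (z i j)) := by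
  rcases Int.even_or_odd k with hk | hk
  · exact Or.inl fun i j hpos => (Int.even_sub.1 (h i j hpos)).2 hk
  · exact Or.inr fun i j hpos => (Int.even_sub'.1 (h i j hpos)).2 hk

theorem IsParityPattern.update_zero (hz : IsParityPattern k (N + 1) z) :
    IsParityPattern k N (Function.update z (N + 1) 0) := by
  have position {i j} (h : IsPosition N i j) : i ≠ N + 1 ∧ IsPosition (N + 1) i j := by
    grind [IsPosition]
  have even_sub i j (h : IsPosition N i j) : Even (Function.update z (N + 1) 0 i j - k) := by
    simpa only [Function.update_of_ne (position h).1] using hz.even_sub i j (position h).2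
  refine ⟨⟨fun i j h => ?_, integral_of_even_sub even_sub, fun i j h => ?_, fun i j h h' => ?_,
    fun i j h h' => ?_⟩, even_sub⟩
  · rw [Function.update_apply]
    split_ifs with hi
    · rfl
    · exact hz.zero_outside i j (by grind [IsPosition])
  · simpa only [Function.update_of_ne (position h).1] using hz.nonneg i j (position h).2
  · simpa only [Function.update_of_ne (position h).1, Function.update_of_ne (position h').1] using
      hz.le_below i j (position h).2 (position h').2
  · simpa only [Function.update_of_ne (position h).1, Function.update_of_ne (position h').1] using
      hz.below_le i j (position h).2 (position h').2

theorem IsParityPattern.isNextRow (hz : IsParityPattern k (N + 1) z) :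
    IsNextRow k N (z N) (z (N + 1)) where
  zero_outside j := hz.zero_outside (N + 1) j
  even_sub j := hz.even_sub (N + 1) j
  nonneg j := hz.nonneg (N + 1) j
  le_below j h := hz.le_below N j (by grind [IsPosition]) (by grind [IsPosition])
  below_le j h := hz.below_le N j (by grind [IsPosition])

theorem IsParityPattern.update {v : ℕ → ℤ} (hz : IsParityPattern k N z)
    (hv : IsNextRow k N (z N) v) : IsParityPattern k (N + 1) (Function.update z (N + 1) v) := by
  have update_eq i j : Function.update z (N + 1) v i j = if i = N + 1 then v j else z i j := by
    rw [Function.update_apply, apply_ite (fun row : ℕ → ℤ => row j)]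
  have even_sub i j (h : IsPosition (N + 1) i j) :
      Even (Function.update z (N + 1) v i j - k) := by
    have := hz.even_sub i j
    have := hv.even_sub j
    grind [IsPosition]
  refine ⟨⟨fun i j h => ?_, integral_of_even_sub even_sub, fun i j h => ?_, fun i j h h' => ?_,
    fun i j h h' => ?_⟩, even_sub⟩
  · have := hz.zero_outside i j
    have := hv.zero_outside j
    grind [IsPosition]
  · have := hz.nonneg i j
    have := hv.nonneg j
    grind [IsPosition]
  · have := hz.le_below i j
    have := hv.le_below j
    grind [IsPosition]
  · have := hz.below_le i j
    have := hv.below_le j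
    grind [IsPosition]

/-- The vector `lam` as a sequence indexed from `1` and extended by zero, like a row of a
pattern. -/
noncomputable def entries {n : ℕ} (lam : Fin n → ℤ) : ℕ → ℤ :=
  Function.extend (fun j : Fin n => (j : ℕ) + 1) lam fun _ => 0

theorem entries_add_one {n : ℕ} (lam : Fin n → ℤ) (j : Fin n) : entries lam (j + 1) = lam j :=
  Function.Injective.extend_apply (fun i j h => by simpa [Fin.ext_iff] using h) lam _ j

theorem entries_eq_zero {n : ℕ} (lam : Fin n → ℤ) {j : ℕ} (hj : ¬(1 ≤ j ∧ j ≤ n)) :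
    entries lam j = 0 :=
  Function.extend_apply' lam _ j (by rintro ⟨i, rfl⟩; omega)

theorem forall_one_le_and_le_iff {n : ℕ} {P : ℕ → Prop} :
    (∀ j, 1 ≤ j ∧ j ≤ n → P j) ↔ ∀ j : Fin n, P (j + 1) := by
  refine ⟨fun h j => h _ (by omega), fun h j hj => ?_⟩
  simpa [Nat.sub_add_cancel hj.1] using h ⟨j - 1, by omega⟩

theorem eq_entries {n : ℕ} {lam : Fin n → ℤ} {v : ℕ → ℤ} (hv : ∀ j : Fin n, v (j + 1) = lam j)
    (zero_outside : ∀ j, ¬(1 ≤ j ∧ j ≤ n) → v j = 0) : v = entries lam := by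
  have hpos : ∀ j, 1 ≤ j ∧ j ≤ n → v j = entries lam j :=
    forall_one_le_and_le_iff.2 fun j => by rw [hv, entries_add_one]
  funext j
  by_cases hj : 1 ≤ j ∧ j ≤ n
  · exact hpos j hj
  · rw [zero_outside j hj, entries_eq_zero lam hj]

theorem mem_toFinset_orthogonalPatterns_iff {n : ℕ} (hn : n = (N + 1) / 2) {lam : Fin n → ℤ}
    (hlam : ∀ j, Even (lam j - k)) :
    z ∈ (orthogonalPatterns_finite N hn.ge lam).toFinset ↔
      IsParityPattern k N z ∧ z N = entries lam := by
  rw [Set.Finite.mem_toFinset]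
  constructor
  · rintro ⟨hz, hbottom⟩
    have hbottom_eq : z N = entries lam :=
      eq_entries hbottom fun j hj => hz.zero_outside N j (by grind [IsPosition])
    refine ⟨⟨hz, fun i j hpos => ?_⟩, hbottom_eq⟩
    have hn_pos : 0 < n := by grind [IsPosition]
    have hcorner : Even (z N 1 - k) := by simpa [← hbottom ⟨0, hn_pos⟩] using hlam ⟨0, hn_pos⟩
    rcases hz.integral with h | h <;>
    · have := h i j hpos
      have := h N 1 (by grind [IsPosition])
      grind
  · rintro ⟨hz, hbottom⟩
    exact ⟨hz.toIsOrthogonalPattern, fun j => by rw [hbottom, entries_add_one]⟩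

theorem sum_orthogonalPatterns {M : Type*} [AddCommMonoid M] {m n : ℕ} (hm : m = (N + 1) / 2)
    (hn : n = (N + 2) / 2) {lam : Fin n → ℤ} (hlam : ∀ j, Even (lam j - k))
    {rows : Finset (Fin m → ℤ)} (hrows : ∀ mu, mu ∈ rows ↔ (∀ j, Even (mu j - k)) ∧
      (∀ j : Fin m, N ≠ 2 * j + 1 → 0 ≤ mu j) ∧ IsNextRow k N (entries mu) (entries lam))
    (f : (ℕ → ℕ → ℤ) → M) :
    ∑ z ∈ (orthogonalPatterns_finite (N + 1) hn.ge lam).toFinset, f z =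
      ∑ mu ∈ rows, ∑ z ∈ (orthogonalPatterns_finite N hm.ge mu).toFinset,
        f (Function.update z (N + 1) (entries lam)) := by
  have mem_sigma (mu : Fin m → ℤ) (z) :
      ⟨mu, z⟩ ∈ rows.sigma (fun mu => (orthogonalPatterns_finite N hm.ge mu).toFinset) ↔
        ((∀ j, Even (mu j - k)) ∧ (∀ j : Fin m, N ≠ 2 * j + 1 → 0 ≤ mu j) ∧
          IsNextRow k N (entries mu) (entries lam)) ∧ IsParityPattern k N z ∧ z N = entries mu := by
    rw [Finset.mem_sigma, hrows]
    exact and_congr_right fun h => mem_toFinset_orthogonalPatterns_iff hm h.1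
  have restore {z} (hz : z ∈ (orthogonalPatterns_finite (N + 1) hn.ge lam).toFinset) :
      Function.update (Function.update z (N + 1) 0) (N + 1) (entries lam) = z := by
    rw [Function.update_idem, ← ((mem_toFinset_orthogonalPatterns_iff hn hlam).1 hz).2,
      Function.update_eq_self]
  rw [Finset.sum_sigma']
  refine Finset.sum_bij' (fun z _ => ⟨fun j => z N (j + 1), Function.update z (N + 1) 0⟩)
    (fun x _ => Function.update x.2 (N + 1) (entries lam)) ?_ ?_ (fun z hz => restore hz) ?_
    fun z hz => by rw [restore hz]
  · intro z hz
    obtain ⟨hz, hbottom⟩ := (mem_toFinset_orthogonalPatterns_iff hn hlam).1 hz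
    have hrow : z N = entries fun j : Fin m => z N (j + 1) :=
      eq_entries (fun _ => rfl) fun j hj => hz.zero_outside N j (by grind [IsPosition])
    refine (mem_sigma _ _).2 ⟨⟨fun j => hz.even_sub N _ (by grind [IsPosition]), fun j hj =>
      hz.nonneg N _ (by grind [IsPosition]) (by omega), ?_⟩, hz.update_zero, ?_⟩
    · rw [← hrow, ← hbottom]
      exact hz.isNextRow
    · rw [← hrow, Function.update_of_ne N.lt_succ_self.ne]
  · rintro ⟨mu, z⟩ hx
    obtain ⟨⟨-, -, hnext⟩, hz, hrow⟩ := (mem_sigma mu z).1 hx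
    rw [← hrow] at hnext
    exact (mem_toFinset_orthogonalPatterns_iff hn hlam).2
      ⟨hz.update hnext, Function.update_self ..⟩
  · rintro ⟨mu, z⟩ hx
    obtain ⟨-, hz, hrow⟩ := (mem_sigma mu z).1 hx
    have hzero : (0 : ℕ → ℤ) = z (N + 1) :=
      funext fun j => (hz.zero_outside (N + 1) j (by grind [IsPosition])).symm
    simp only [Function.update_idem, hzero, Function.update_eq_self,
      Function.update_of_ne N.lt_succ_self.ne, hrow, entries_add_one]

theorem isNextRow_odd_iff {n : ℕ} {mu : Fin n → ℤ} {lam : Fin (n + 1) → ℤ} :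
    IsNextRow k (2 * n) (entries mu) (entries lam) ↔ (∀ j, Even (lam j - k)) ∧
      ∀ j : Fin n, 0 ≤ lam j.castSucc ∧ |mu j| ≤ |lam j.castSucc| ∧ |lam j.succ| ≤ |mu j| := by
  have lam_castSucc (j : Fin n) : entries lam (j + 1) = lam j.castSucc :=
    entries_add_one lam j.castSucc
  have lam_succ (j : Fin n) : entries lam (j + 1 + 1) = lam j.succ := entries_add_one lam j.succ
  constructor
  · refine fun h => ⟨fun j => ?_, fun j => ⟨?_, ?_, ?_⟩⟩
    · simpa only [entries_add_one] using h.even_sub (j + 1) (by grind [IsPosition])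
    · simpa only [lam_castSucc] using h.nonneg (j + 1) (by grind [IsPosition]) (by omega)
    · simpa only [entries_add_one, lam_castSucc] using h.le_below (j + 1) (by grind [IsPosition])
    · simpa only [entries_add_one, lam_succ] using
        h.below_le (j + 1) (by grind [IsPosition]) (by grind [IsPosition])
  · rintro ⟨hparity, hrow⟩
    have even_sub : ∀ j, 1 ≤ j ∧ j ≤ n + 1 → Even (entries lam j - k) :=
      forall_one_le_and_le_iff.2 fun j => by simpa only [entries_add_one] using hparity j
    have interlace : ∀ j, 1 ≤ j ∧ j ≤ n → 0 ≤ entries lam j ∧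
        |entries mu j| ≤ |entries lam j| ∧ |entries lam (j + 1)| ≤ |entries mu j| :=
      forall_one_le_and_le_iff.2 fun j => by
        simpa only [entries_add_one, lam_castSucc, lam_succ] using hrow j
    exact ⟨fun j hj => entries_eq_zero lam (by grind [IsPosition]),
      fun j hj => even_sub j (by grind [IsPosition]),
      fun j hj _ => (interlace j (by grind [IsPosition])).1,
      fun j hj => (interlace j (by grind [IsPosition])).2.1,
      fun j hj _ => (interlace j (by grind [IsPosition])).2.2⟩

theorem isNextRow_even_iff {p : ℕ} {nu mu : Fin (p + 1) → ℤ} :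
    IsNextRow k (2 * p + 1) (entries nu) (entries mu) ↔ (∀ j, Even (mu j - k)) ∧
      (∀ j, 0 ≤ mu j ∧ |nu j| ≤ |mu j|) ∧ ∀ j : Fin p, |mu j.succ| ≤ |nu j.castSucc| := by
  have nu_castSucc (j : Fin p) : entries nu (j + 1) = nu j.castSucc :=
    entries_add_one nu j.castSucc
  have mu_succ (j : Fin p) : entries mu (j + 1 + 1) = mu j.succ := entries_add_one mu j.succ
  constructor
  · refine fun h => ⟨fun j => ?_, fun j => ⟨?_, ?_⟩, fun j => ?_⟩
    · simpa only [entries_add_one] using h.even_sub (j + 1) (by grind [IsPosition])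
    · simpa only [entries_add_one] using h.nonneg (j + 1) (by grind [IsPosition]) (by omega)
    · simpa only [entries_add_one] using h.le_below (j + 1) (by grind [IsPosition])
    · simpa only [nu_castSucc, mu_succ] using
        h.below_le (j + 1) (by grind [IsPosition]) (by grind [IsPosition])
  · rintro ⟨hparity, hbelow, habove⟩
    have row : ∀ j, 1 ≤ j ∧ j ≤ p + 1 → Even (entries mu j - k) ∧ 0 ≤ entries mu j ∧
        |entries nu j| ≤ |entries mu j| :=
      forall_one_le_and_le_iff.2 fun j => by
        simpa only [entries_add_one] using ⟨hparity j, hbelow j⟩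
    have interlace : ∀ j, 1 ≤ j ∧ j ≤ p → |entries mu (j + 1)| ≤ |entries nu j| :=
      forall_one_le_and_le_iff.2 fun j => by simpa only [nu_castSucc, mu_succ] using habove j
    exact ⟨fun j hj => entries_eq_zero mu (by grind [IsPosition]),
      fun j hj => (row j (by grind [IsPosition])).1,
      fun j hj _ => (row j (by grind [IsPosition])).2.1,
      fun j hj => (row j (by grind [IsPosition])).2.2,
      fun j _ hj => interlace j (by grind [IsPosition])⟩

theorem mem_evenRowsAbove_iff_isNextRow {k n : ℕ} {lam : Fin (n + 1) → ℤ}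
    (hlam : lam ∈ signedPartitionsIn (n + 1) k) (mu : Fin n → ℤ) :
    mu ∈ evenRowsAbove k lam ↔ (∀ j, Even (mu j - k)) ∧
      (∀ j : Fin n, 2 * n ≠ 2 * j + 1 → 0 ≤ mu j) ∧
        IsNextRow k (2 * n) (entries mu) (entries lam) := by
  have hlam_abs := abs_castSucc_of_mem_signedPartitionsIn hlam
  have hlam_parity := (mem_signedPartitionsIn.1 hlam).2.1
  have lam_nonneg (j : Fin n) : 0 ≤ lam j.castSucc := hlam_abs j ▸ abs_nonneg _
  simp only [mem_evenRowsAbove, isNextRow_odd_iff, hlam_abs, lam_nonneg, hlam_parity,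
    implies_true, true_and, forall_and]
  grind

theorem mem_oddRowsAbove_iff_isNextRow {p : ℕ} {mu : Fin (p + 1) → ℤ}
    (mu_nonneg : ∀ j, 0 ≤ mu j) (mu_even_sub : ∀ j, Even (mu j - k)) (nu : Fin (p + 1) → ℤ) :
    nu ∈ oddRowsAbove k mu ↔ (∀ j, Even (nu j - k)) ∧
      (∀ j : Fin (p + 1), 2 * p + 1 ≠ 2 * j + 1 → 0 ≤ nu j) ∧
        IsNextRow k (2 * p + 1) (entries nu) (entries mu) := by
  simp only [mem_oddRowsAbove, isNextRow_even_iff, abs_of_nonneg (mu_nonneg _), mu_nonneg,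
    mu_even_sub, implies_true, true_and, Fin.forall_fin_succ' (n := p), Fin.val_castSucc,
    Fin.val_last]
  grind

end Patterns

section BranchingRule

variable {R : Type*} [CommRing R] {k n : ℕ}

theorem weightExponent_congr {z z' : ℕ → ℕ → ℤ} {m : ℕ} (h : ∀ i ≤ 2 * m + 1, z i = z' i) :
    weightExponent z (m + 1) = weightExponent z' (m + 1) := by
  unfold weightExponent patternType
  rw [h 1 (by omega), h (2 * (m + 1) - 3) (by omega), h (2 * (m + 1) - 1) (by omega),
    h (2 * (m + 1) - 1 - 1) (by omega), h (2 * (m + 1) - 2) (by omega),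
    h (2 * (m + 1) - 2 - 1) (by omega)]

theorem patternWeight_congr (r : Fin n → Rˣ) {z z' : ℕ → ℕ → ℤ}
    (h : ∀ i ≤ 2 * n - 1, z i = z' i) : patternWeight r z = patternWeight r z' := by
  unfold patternWeight
  congr 1
  exact Finset.prod_congr rfl fun m _ => by
    rw [weightExponent_congr fun i hi => h i (by omega)]

theorem patternWeight_snoc (r : Fin n → Rˣ) (q : Rˣ) (z : ℕ → ℕ → ℤ) :
    (patternWeight (Fin.snoc r q : Fin (n + 1) → Rˣ) z : R) =
      ↑(q ^ weightExponent z (n + 1)) * patternWeight r z := by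
  simp [patternWeight, Fin.prod_univ_castSucc, mul_comm]

theorem sum_Icc_abs_entries (lam : Fin n → ℤ) :
    ∑ j ∈ Finset.Icc 1 n, |entries lam j| = ∑ j, |lam j| := by
  rw [← Finset.Ico_add_one_right_eq_Icc, ← zero_add 1, ← Finset.sum_Ico_add', ← Finset.range_eq_Ico,
    ← Fin.sum_univ_eq_sum_range (fun j => |entries lam (j + (0 + 1))|)]
  simp only [zero_add, entries_add_one]

theorem weightExponent_add_two {p : ℕ} {z : ℕ → ℕ → ℤ} {lam : Fin (p + 2) → ℤ}
    {mu nu : Fin (p + 1) → ℤ} (hlam : z (2 * p + 3) = entries lam)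
    (hmu : z (2 * p + 2) = entries mu) (hnu : z (2 * p + 1) = entries nu) :
    weightExponent z (p + 2) =
      lastSgn lam * lastSgn nu * (∑ i, |lam i| + ∑ i, |nu i| - 2 * ∑ j, |mu j|) := by
  have lam_last : lastSgn lam = sgn (z (2 * p + 3) (p + 2)) := by
    rw [hlam]
    exact congrArg sgn (entries_add_one lam (Fin.last (p + 1))).symm
  have nu_last : lastSgn nu = sgn (z (2 * p + 1) (p + 1)) := by
    rw [hnu]
    exact congrArg sgn (entries_add_one nu (Fin.last p)).symm
  have type_odd : patternType z (2 * p + 3) = ∑ i, |lam i| - ∑ j, |mu j| := by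
    rw [patternType, ← sum_Icc_abs_entries, ← sum_Icc_abs_entries, ← hlam, ← hmu]
    congr 3 <;> omega
  have type_even : patternType z (2 * p + 2) = ∑ j, |mu j| - ∑ i, |nu i| := by
    rw [patternType, ← sum_Icc_abs_entries, ← sum_Icc_abs_entries, ← hmu, ← hnu]
    congr 3 <;> omega
  rw [weightExponent, if_neg (by omega), lam_last, nu_last,
    show 2 * (p + 2) - 1 = 2 * p + 3 by omega, show 2 * (p + 2) - 2 = 2 * p + 2 by omega,
    show 2 * (p + 2) - 3 = 2 * p + 1 by omega, show p + 2 - 1 = p + 1 by omega, type_odd, type_even]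
  ring

theorem soEven_snoc_eq_sum_evenRowsAbove {lam : Fin (n + 1) → ℤ}
    (hlam : lam ∈ signedPartitionsIn (n + 1) k) (r : Fin n → Rˣ) (q : Rˣ) :
    soEven lam (Fin.snoc r q : Fin (n + 1) → Rˣ) = ∑ mu ∈ evenRowsAbove k lam,
      ∑ z ∈ (orthogonalPatterns_finite (2 * n) (by omega) mu).toFinset,
        ↑(q ^ weightExponent (Function.update z (2 * n + 1) (entries lam)) (n + 1)) *
          patternWeight r z := by
  refine (sum_orthogonalPatterns (by omega) (by omega) (mem_signedPartitionsIn.1 hlam).2.1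
    (mem_evenRowsAbove_iff_isNextRow hlam) (patternWeight (Fin.snoc r q))).trans ?_
  refine Finset.sum_congr rfl fun mu _ => Finset.sum_congr rfl fun z _ => ?_
  rw [patternWeight_snoc, patternWeight_congr r fun i hi => Function.update_of_ne (by omega) _ _]

theorem soEven_zero (lam : Fin 0 → ℤ) (r : Fin 0 → Rˣ) : soEven lam r = 1 := by
  have hpos (i j) : ¬IsPosition 0 i j := by grind [IsPosition]
  have orthogonalPatterns_eq :
      (orthogonalPatterns_finite (2 * 0 - 1) (by omega) lam).toFinset = {0} := by
    ext z
    rw [Set.Finite.mem_toFinset, Finset.mem_singleton]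
    refine ⟨fun hz => funext₂ fun i j => hz.1.zero_outside i j (hpos i j), ?_⟩
    rintro rfl
    exact ⟨⟨fun _ _ _ => rfl, Or.inl fun i j h => (hpos i j h).elim,
      fun i j h => (hpos i j h).elim, fun i j h => (hpos i j h).elim,
      fun i j h => (hpos i j h).elim⟩, fun j => j.elim0⟩
  rw [soEven, orthogonalPatterns_eq, Finset.sum_singleton]
  simp [patternWeight]

theorem signedPartitionsIn_zero (k : ℕ) : signedPartitionsIn 0 k = Finset.univ := by
  simp only [Finset.eq_univ_iff_forall, mem_signedPartitionsIn, IsEmpty.forall_iff, implies_true,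
    and_self]

theorem branch_zero (k : ℕ) (lam : Fin 1 → ℤ) (nu : Fin 0 → ℤ) (q : Rˣ) :
    (branch k lam nu q : R) = ↑(q ^ lam 0) := by
  have interlacers_eq : interlacers k |lam| (Fin.cons (k : ℤ) |nu|) = {0} :=
    Finset.eq_singleton_iff_unique_mem.2
      ⟨mem_interlacers.2 nofun, fun mu _ => Subsingleton.elim _ _⟩
  rw [branch_eq_sum_lastSgn, interlacers_eq, Finset.sum_singleton]
  simp [lastSgn, sgn_mul_abs]

theorem sum_weightExponent_eq_sum_oddRowsAbove {p : ℕ} {lam : Fin (p + 2) → ℤ}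
    {mu : Fin (p + 1) → ℤ} (hmu : mu ∈ evenRowsAbove k lam) (r : Fin (p + 1) → Rˣ) (q : Rˣ) :
    ∑ z ∈ (orthogonalPatterns_finite (2 * (p + 1)) (by omega) mu).toFinset,
        (↑(q ^ weightExponent (Function.update z (2 * (p + 1) + 1) (entries lam)) (p + 2)) *
          patternWeight r z : R) =
      ∑ nu ∈ oddRowsAbove k mu,
        ↑(q ^ (lastSgn lam * lastSgn nu * (∑ i, |lam i| + ∑ i, |nu i| - 2 * ∑ j, mu j))) *
          soEven nu r := by
  rw [mem_evenRowsAbove] at hmu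
  have mu_nonneg (j) : 0 ≤ mu j := (abs_nonneg _).trans (hmu j).1.1
  refine (sum_orthogonalPatterns (N := 2 * p + 1) (by omega) (by omega) (fun j => (hmu j).2)
    (mem_oddRowsAbove_iff_isNextRow mu_nonneg fun j => (hmu j).2) _).trans ?_
  refine Finset.sum_congr rfl fun nu hnu => ?_
  rw [soEven, Finset.mul_sum]
  refine Finset.sum_congr rfl fun z hz => ?_
  have hbottom : z (2 * p + 1) = entries nu :=
    ((mem_toFinset_orthogonalPatterns_iff (by omega) (mem_oddRowsAbove.1 hnu).1).1 hz).2
  have hexponent := weightExponent_add_two (lam := lam) (mu := mu) (nu := nu)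
    (z := Function.update (Function.update z (2 * p + 2) (entries mu)) (2 * p + 3) (entries lam))
    (Function.update_self ..)
    ((Function.update_of_ne (by omega) _ _).trans (Function.update_self ..))
    ((Function.update_of_ne (by omega) _ _).trans
      ((Function.update_of_ne (by omega) _ _).trans hbottom))
  simp only [abs_of_nonneg (mu_nonneg _)] at hexponent
  rw [patternWeight_congr r fun i hi => Function.update_of_ne (by omega) _ _, ← hexponent]
  rfl

theorem soEven_snoc {lam : Fin (n + 1) → ℤ} (hlam : lam ∈ signedPartitionsIn (n + 1) k)
    (r : Fin n → Rˣ) (q : Rˣ) :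
    soEven lam (Fin.snoc r q : Fin (n + 1) → Rˣ) =
      ∑ nu ∈ signedPartitionsIn n k, branch k lam nu q * soEven nu r := by
  cases n with
  | zero =>
    have weightExponent_one (z : ℕ → ℕ → ℤ) :
        weightExponent (Function.update z 1 (entries lam)) 1 = lam 0 := by
      simpa [weightExponent] using entries_add_one lam 0
    have evenRowsAbove_eq : evenRowsAbove k lam = Finset.univ := by
      simp only [Finset.eq_univ_iff_forall, mem_evenRowsAbove, IsEmpty.forall_iff, implies_true]
    rw [soEven_snoc_eq_sum_evenRowsAbove hlam, evenRowsAbove_eq, signedPartitionsIn_zero]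
    refine Finset.sum_congr rfl fun nu _ => ?_
    rw [soEven, Finset.mul_sum]
    refine Finset.sum_congr rfl fun z _ => ?_
    rw [branch_zero, ← weightExponent_one z]
  | succ p =>
    rw [soEven_snoc_eq_sum_evenRowsAbove hlam, Finset.sum_congr rfl fun mu hmu =>
      sum_weightExponent_eq_sum_oddRowsAbove hmu r q]
    simp only [branch_eq_sum_lastSgn, Finset.sum_mul]
    exact Finset.sum_comm' fun mu nu => by
      rw [and_comm, ← mem_signedPartitionsIn_and_mem_interlacers_iff hlam, and_comm]

theorem soOdd_rect (k n : ℕ) (r : Fin n → Rˣ) :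
    soOdd (rect k n) r = soEven (rect k (n + 1)) (Fin.snoc r 1 : Fin (n + 1) → Rˣ) := by
  have evenRowsAbove_rect : evenRowsAbove k (rect k (n + 1)) = {rect k n} := by
    ext mu
    simp only [mem_evenRowsAbove, rect, Nat.abs_cast, Finset.mem_singleton, funext_iff]
    grind
  simp only [soEven_snoc_eq_sum_evenRowsAbove (rect_mem_signedPartitionsIn k (n + 1)),
    evenRowsAbove_rect, Finset.sum_singleton, one_zpow, Units.val_one, one_mul]
  rfl

end BranchingRule

section Determinants

variable {R : Type*} [CommRing R] {n : ℕ}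

open Matrix

theorem det_eq_of_forall_row_eq_smul_add_succ {A B : Fin (n + 1) → Fin (n + 1) → R}
    (c : Fin n → R) (hlast : A (Fin.last n) = B (Fin.last n))
    (hcastSucc : ∀ i, A i.castSucc = B i.castSucc + c i • A i.succ) : det (of A) = det (of B) := by
  rw [← det_submatrix_equiv_self Fin.revPerm (of A), ← det_submatrix_equiv_self Fin.revPerm (of B)]
  refine det_eq_of_forall_row_eq_smul_add_pred (fun i => c i.rev) (fun j => ?_) fun i j => ?_
  · simp [hlast]
  · simpa [Fin.rev_succ, Fin.rev_castSucc] using congrFun (hcastSucc i.rev) j.rev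

/-- The determinant of a square matrix as a function of its rows, multilinear in all rows but the
last and linear in the last row. -/
def borderedDet : MultilinearMap R (fun _ : Fin n => Fin (n + 1) → R)
    ((Fin (n + 1) → R) →ₗ[R] R) :=
  (detRowAlternating (R := R) (n := Fin (n + 1))).toMultilinearMap.curryRight

theorem borderedDet_apply (A : Fin n → Fin (n + 1) → R) (b : Fin (n + 1) → R) :
    borderedDet A b = det (of (Fin.snoc A b : Fin (n + 1) → Fin (n + 1) → R)) :=
  rfl

theorem borderedDet_sub_succ {v : Fin (n + 1) → Fin (n + 1) → R} {b : Fin (n + 1) → R} {c : R}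
    (hc : v (Fin.last n) = c • b) :
    borderedDet (fun j : Fin n => v j.castSucc - v j.succ) b =
      borderedDet (fun j : Fin n => v j.castSucc) b := by
  rw [borderedDet_apply, borderedDet_apply]
  cases n with
  | zero => congr 1
  | succ n =>
    refine (det_eq_of_forall_row_eq_smul_add_succ (Fin.snoc 1 c : Fin (n + 1) → R) (by simp)
      (Fin.lastCases (by simp [← hc]) fun j => ?_)).symm
    simp only [Fin.succ_castSucc, Fin.snoc_castSucc, Pi.one_apply, one_smul, sub_add_cancel]

/-- The cofactor expansion along the last column, which the row operations `A j - A (j + 1)` reduce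
to two entries. -/
theorem borderedDet_eq_of_forall_last_eq {A : Fin (n + 1) → Fin (n + 2) → R} {κ : R}
    (hκ : ∀ j, A j (Fin.last (n + 1)) = κ) (b : Fin (n + 2) → R) :
    borderedDet A b = borderedDet (fun j : Fin n => Fin.init (A j.castSucc - A j.succ))
      (Fin.init (b (Fin.last (n + 1)) • A (Fin.last n) - κ • b)) := by
  let N : Fin (n + 2) → Fin (n + 2) → R :=
    Fin.snoc (Fin.snoc (fun j => A j.castSucc - A j.succ) (A (Fin.last n)) :
      Fin (n + 1) → Fin (n + 2) → R) b
  have row_operations : borderedDet A b = det (of N) := by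
    rw [borderedDet_apply]
    refine det_eq_of_forall_row_eq_smul_add_succ (Fin.snoc 1 0 : Fin (n + 1) → R) (by simp [N])
      (Fin.lastCases (by simp [N]) fun j => ?_)
    simp only [N, Fin.succ_castSucc, Fin.snoc_castSucc, Pi.one_apply, one_smul, sub_add_cancel]
  have minor (f : Fin (n + 1) → Fin (n + 2))
      (hf : ∀ j : Fin n, N (f j.castSucc) = A j.castSucc - A j.succ) :
      (submatrix (of N) f Fin.castSucc).det =
        borderedDet (fun j : Fin n => Fin.init (A j.castSucc - A j.succ))
          (Fin.init (N (f (Fin.last n)))) := by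
    rw [borderedDet_apply]
    refine congrArg det (funext fun j => ?_)
    cases j using Fin.lastCases with
    | last => simp [Fin.snoc_last, Fin.init_def, funext_iff]
    | cast j => simp [Fin.snoc_castSucc, Fin.init_def, funext_iff, hf]
  have init_border : Fin.init (b (Fin.last (n + 1)) • A (Fin.last n) - κ • b) =
      b (Fin.last (n + 1)) • Fin.init (A (Fin.last n)) - κ • Fin.init b :=
    rfl
  rw [row_operations, det_succ_column _ (Fin.last (n + 1)), Fin.sum_univ_castSucc,
    Fin.sum_univ_castSucc, Finset.sum_eq_zero fun j _ => by simp [N, hκ], init_border, map_sub,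
    map_smul, map_smul, Fin.succAbove_last, minor _ fun j => ?_, minor _ fun j => ?_]
  · simp [N, hκ, sub_eq_neg_add]
  · simp [N]
  · simp [N, Fin.succAbove_of_castSucc_lt]

end Determinants

section TelescopingSums

variable {R : Type*} [CommRing R]

theorem val_zpow_add (q : Rˣ) (a b : ℤ) : (↑(q ^ (a + b)) : R) = ↑(q ^ a) * ↑(q ^ b) := by
  rw [zpow_add, Units.val_mul]

theorem prod_val_zpow {ι : Type*} (s : Finset ι) (q : Rˣ) (a : ι → ℤ) :
    ∏ j ∈ s, (↑(q ^ a j) : R) = ↑(q ^ ∑ j ∈ s, a j) := by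
  classical
  induction s using Finset.induction_on with
  | empty => simp
  | insert j s hj ih => rw [Finset.prod_insert hj, Finset.sum_insert hj, ih, val_zpow_add]

/-- The entries `a ^ l + s * a ^ (-l)` of the determinants in the Weyl character formula, where the
sign `s` is `1` or `-1`. -/
def twoTerm (s : R) (a : Rˣ) (l : ℤ) : R :=
  ↑(a ^ l) + s * ↑(a ^ (-l))

theorem twoTerm_neg {s : R} (hs : s * s = 1) (a : Rˣ) (l : ℤ) :
    twoTerm s a (-l) = s * twoTerm s a l := by
  simp only [twoTerm, neg_neg]
  linear_combination (-(↑(a ^ (-l)) : R)) * hs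

theorem exists_forall_twoTerm_abs_eq {s : R} (hs : s * s = 1) (l : ℤ) :
    ∃ c : R, ∀ a, twoTerm s a |l| = c * twoTerm s a l := by
  rcases abs_choice l with h | h
  · exact ⟨1, fun a => by rw [h, one_mul]⟩
  · exact ⟨s, fun a => by rw [h, twoTerm_neg hs]⟩

/-- The function `x + x⁻¹` of the variable `x = a ^ 2`. -/
def trace (a : Rˣ) : R :=
  ↑(a ^ (2 : ℤ)) + ↑(a ^ (-2 : ℤ))

/-- The partial sums of `q ^ m * ((trace a - trace q) * twoTerm s a m)`, for `m` running through the
integers of one parity; see `partialSum_sub`. -/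
def partialSum (s : R) (a q : Rˣ) (m : ℤ) : R :=
  ↑(q ^ m) * (twoTerm s a (m + 2) - ↑(q ^ (2 : ℤ)) * twoTerm s a m)

theorem val_zpow_two_mul_val_zpow_neg_two (q : Rˣ) :
    (↑(q ^ (2 : ℤ)) : R) * ↑(q ^ (-2 : ℤ)) = 1 := by
  rw [← val_zpow_add]
  simp

theorem partialSum_sub (s : R) (a q : Rˣ) (m : ℤ) :
    partialSum s a q m - partialSum s a q (m - 2) =
      ↑(q ^ m) * ((trace a - trace q) * twoTerm s a m) := by
  have hq : (↑(q ^ (m - 2)) : R) = ↑(q ^ m) * ↑(q ^ (-2 : ℤ)) := by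
    rw [← val_zpow_add, sub_eq_add_neg]
  have three_term_recurrence :
      twoTerm s a (m + 2) + twoTerm s a (m - 2) = trace a * twoTerm s a m := by
    simp only [twoTerm, trace]
    rw [show -(m + 2) = -m + -2 by ring, show -(m - 2) = -m + 2 by ring,
      show m - 2 = m + -2 by ring]
    simp only [val_zpow_add]
    ring
  simp only [partialSum, hq, sub_add_cancel]
  rw [sub_mul, ← three_term_recurrence]
  simp only [trace]
  linear_combination (↑(q ^ m) * twoTerm s a (m - 2)) * val_zpow_two_mul_val_zpow_neg_two q

theorem partialSum_self (s : R) (q : Rˣ) (m : ℤ) :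
    partialSum s q q m = s * (↑(q ^ (-2 : ℤ)) - ↑(q ^ (2 : ℤ))) := by
  have hq : (↑(q ^ m) : R) * ↑(q ^ (-m)) = 1 := by
    rw [← val_zpow_add]
    simp
  simp only [partialSum, twoTerm]
  rw [neg_add]
  simp only [val_zpow_add]
  linear_combination (s * (↑(q ^ (-2 : ℤ)) - ↑(q ^ (2 : ℤ)))) * hq

theorem sum_zpow_mul_twoTerm (s : R) (a q : Rˣ) {k x y : ℤ} (hx : Even (x - k))
    (hy : Even (y - k)) (hxy : x ≤ y + 2) (c : ℤ) :
    ∑ t ∈ parityIcc k x y, ↑(q ^ t) * ((trace a - trace q) * twoTerm s a (t + c)) =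
      ↑(q ^ (-c)) * (partialSum s a q (y + c) - partialSum s a q (x + c - 2)) := by
  have telescope := sum_parityIcc_telescope
    (fun t => ↑(q ^ (-c)) * partialSum s a q (t + c - 2)) hx hy hxy
  rw [mul_sub, show y + c = y + 2 + c - 2 by ring, ← telescope]
  refine Finset.sum_congr rfl fun t _ => ?_
  rw [← mul_sub, show t + 2 + c - 2 = t + c by ring, partialSum_sub,
    ← mul_assoc (↑(q ^ (-c)) : R), ← val_zpow_add, neg_add_cancel_comm_assoc]

theorem partialSum_boundary {s : R} (hs : s * s = 1) (a q : Rˣ) (l : ℤ) :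
    ↑(q ^ l) * partialSum s a q (-l - 2) + s * (↑(q ^ (-l)) * partialSum s a q l) =
      s * (↑(q ^ (-2 : ℤ)) - ↑(q ^ (2 : ℤ))) * twoTerm s a l := by
  have hq : (↑(q ^ l) : R) * ↑(q ^ (-l)) = 1 := by
    rw [← val_zpow_add]
    simp
  simp only [partialSum]
  rw [show -l - 2 + 2 = -l by ring, show -l - 2 = -(l + 2) by ring, twoTerm_neg hs, twoTerm_neg hs,
    show -(l + 2) = -l + -2 by ring, val_zpow_add]
  linear_combination (s * (↑(q ^ (-2 : ℤ)) * twoTerm s a l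
    - ↑(q ^ (2 : ℤ)) * ↑(q ^ (-2 : ℤ)) * twoTerm s a (l + 2)
    + twoTerm s a (l + 2) - ↑(q ^ (2 : ℤ)) * twoTerm s a l)) * hq
    + (-s * twoTerm s a (l + 2)) * val_zpow_two_mul_val_zpow_neg_two q

/-- The sum is split at `-l`; its lower half is turned around by `t ↦ -t`. -/
theorem sum_zpow_abs_mul_twoTerm {s : R} (hs : s * s = 1) (a q : Rˣ) {k l y : ℤ}
    (hl : Even (l - k)) (hy : Even (y - k)) (hly : |l| ≤ y) :
    ∑ t ∈ parityIcc k (-y) y, ↑(q ^ |t + l|) * ((trace a - trace q) * twoTerm s a t) =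
      twoTerm s q l * partialSum s a q y -
        s * (↑(q ^ (-2 : ℤ)) - ↑(q ^ (2 : ℤ))) * twoTerm s a l := by
  obtain ⟨hyl, hly⟩ := abs_le.1 hly
  have upper_half :
      ∑ t ∈ parityIcc k (-l) y, ↑(q ^ |t + l|) * ((trace a - trace q) * twoTerm s a t) =
        ↑(q ^ l) * (partialSum s a q y - partialSum s a q (-l - 2)) := by
    have h := sum_zpow_mul_twoTerm s a q (k := k) (x := -l) (by grind) hy (by linarith) 0
    simp only [add_zero, neg_zero, zpow_zero, Units.val_one, one_mul] at h
    rw [← h, Finset.mul_sum]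
    refine Finset.sum_congr rfl fun t ht => ?_
    have := (mem_parityIcc.1 ht).1.1
    rw [abs_of_nonneg (by linarith), add_comm, val_zpow_add, mul_assoc]
  have lower_half :
      ∑ t ∈ parityIcc k (-y) (-l - 2), ↑(q ^ |t + l|) * ((trace a - trace q) * twoTerm s a t) =
        s * (↑(q ^ (-l)) * (partialSum s a q y - partialSum s a q l)) := by
    have h := sum_zpow_mul_twoTerm s a q (k := k) (x := l + 2) (by grind) hy (by linarith) 0
    simp only [add_zero, neg_zero, zpow_zero, Units.val_one, one_mul, add_sub_cancel_right] at h
    rw [← h, show -l - 2 = -(l + 2) by ring, sum_parityIcc_neg, Finset.mul_sum, Finset.mul_sum]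
    refine Finset.sum_congr rfl fun t ht => ?_
    have := (mem_parityIcc.1 ht).1.1
    rw [abs_of_neg (by linarith), show -(-t + l) = -l + t by ring, val_zpow_add, twoTerm_neg hs]
    ring
  rw [sum_parityIcc_split _ (c := -l) (by grind) (by linarith) (by linarith), upper_half,
    lower_half, ← partialSum_boundary hs, twoTerm]
  ring

theorem sum_zpow_neg_mul_partialSum (s : R) (a q : Rˣ) {k x y : ℤ} (hx : Even (x - k))
    (hy : Even (y - k)) (hxy : x ≤ y + 2) (c : ℤ) :
    ∑ t ∈ parityIcc k x y, ↑(q ^ (-(2 * t))) * partialSum s a q (t + c) =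
      ↑(q ^ (2 * c + 2)) * (↑(q ^ (-(y + c + 2))) * twoTerm s a (y + c + 2) -
        ↑(q ^ (-(x + c))) * twoTerm s a (x + c)) := by
  have telescope := sum_parityIcc_telescope
    (fun t => ↑(q ^ (-(t + c))) * twoTerm s a (t + c)) hx hy hxy
  rw [show y + c + 2 = y + 2 + c by ring, ← telescope, Finset.mul_sum]
  refine Finset.sum_congr rfl fun t _ => ?_
  rw [partialSum, mul_sub, mul_sub, mul_sub, show t + c + 2 = t + 2 + c by ring]
  simp only [← mul_assoc, ← val_zpow_add]
  ring_nf

end TelescopingSums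

section Alternants

variable {R : Type*} [CommRing R] {k p : ℕ}

open Matrix

/-- The Weyl vector `(n - 1, …, 1, 0)` of `SO(2n)`, doubled. -/
def weylVector {n : ℕ} (j : Fin n) : ℤ := 2 * (j.rev : ℕ)

theorem weylVector_succ {n : ℕ} (j : Fin n) : weylVector j.succ = weylVector j := by
  simp [weylVector, Fin.rev_succ]

theorem weylVector_castSucc {n : ℕ} (j : Fin n) : weylVector j.castSucc = weylVector j + 2 := by
  simp [weylVector, Fin.rev_castSucc, mul_add]

theorem weylVector_last (n : ℕ) : weylVector (Fin.last n) = 0 := by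
  simp [weylVector]

/-- The numerators of the Weyl character formula: `alternant 1 lam r` and `alternant (-1) lam r` are
the two determinants whose sum is twice the alternating sum over the Weyl group of `SO(2n)`. Rows
are indexed by the parts and columns by the variables. -/
def alternant (s : R) {n : ℕ} (lam : Fin n → ℤ) (r : Fin n → Rˣ) : R :=
  det (of fun j i : Fin n => twoTerm s (r i) (lam j + weylVector j))

theorem zpow_sum_mul_alternant_mul_prod (s : R) {n : ℕ} (e nu : Fin n → ℤ) (w : Fin n → Rˣ)
    (q : Rˣ) :
    ↑(q ^ ∑ j, e j) * (alternant s nu w * ∏ i, (trace (w i) - trace q)) =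
      detRowAlternating.toMultilinearMap fun j => (↑(q ^ e j) : R) • fun i =>
        (trace (w i) - trace q) * twoTerm s (w i) (nu j + weylVector j) := by
  rw [MultilinearMap.map_smul_univ, prod_val_zpow, mul_comm (alternant s nu w), alternant,
    ← det_mul_row]
  rfl

theorem sum_oddRowsAbove_mul_alternant {s : R} (hs : s * s = 1) {k l : ℤ} {mu : Fin (p + 1) → ℤ}
    (hparity : ∀ j, Even (mu j - k)) (hmu : ∀ j : Fin p, mu j.succ ≤ mu j.castSucc)
    (hl : Even (l - k)) (hle : |l| ≤ mu (Fin.last p)) (w : Fin (p + 1) → Rˣ) (q : Rˣ) :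
    ∑ nu ∈ oddRowsAbove k mu, ↑(q ^ (∑ j : Fin p, nu j.castSucc + |nu (Fin.last p) + l|)) *
        (alternant s nu w * ∏ i, (trace (w i) - trace q)) =
      ↑(q ^ (-∑ j : Fin (p + 1), weylVector j)) *
        borderedDet (fun j i => partialSum s ((Fin.snoc w q : Fin (p + 2) → Rˣ) i) q
            (mu j + weylVector j))
          fun i => twoTerm s ((Fin.snoc w q : Fin (p + 2) → Rˣ) i) l := by
  let e (t : ℤ) : Fin (p + 1) → ℤ := Fin.snoc (fun _ => t) |t + l|
  have hexp (nu : Fin (p + 1) → ℤ) :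
      ∑ j : Fin p, nu j.castSucc + |nu (Fin.last p) + l| = ∑ j, e (nu j) j := by
    simp [Fin.sum_univ_castSucc, e]
  simp only [hexp, zpow_sum_mul_alternant_mul_prod]
  rw [oddRowsAbove, ← MultilinearMap.map_sum_finset (g := fun j t => (↑(q ^ e t j) : R) • fun i =>
      (trace (w i) - trace q) * twoTerm s (w i) (t + weylVector j)),
    borderedDet_eq_of_forall_last_eq fun j => by rw [Fin.snoc_last, partialSum_self],
    borderedDet_apply, ← Finset.sum_neg_distrib, ← prod_val_zpow, ← smul_eq_mul]
  refine Eq.trans (congrArg _ ?_) (MultilinearMap.map_smul_univ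
    detRowAlternating.toMultilinearMap _ _)
  ext j i
  cases j using Fin.lastCases with
  | last => simpa [e, weylVector_last, Fin.init] using
      sum_zpow_abs_mul_twoTerm hs (w i) q hl (hparity (Fin.last p)) hle
  | cast j =>
    have hshift : mu j.succ + weylVector j.castSucc - 2 = mu j.succ + weylVector j.succ := by
      rw [weylVector_succ, weylVector_castSucc]
      ring
    simpa [e, hshift, Fin.init] using sum_zpow_mul_twoTerm s (w i) q (hparity j.succ)
      (hparity j.castSucc) (by linarith [hmu j]) (weylVector j.castSucc)

theorem smul_zpow_neg_mul_twoTerm (s : R) {n : ℕ} (r : Fin n → Rˣ) (q : Rˣ) (l m : ℤ) :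
    (↑(q ^ m) : R) • (fun i => ↑(q ^ (-l)) * twoTerm s (r i) l) =
      (↑(q ^ (m - l)) : R) • fun i => twoTerm s (r i) l := by
  ext i
  simp only [Pi.smul_apply, smul_eq_mul, ← mul_assoc, ← val_zpow_add, sub_eq_add_neg]

theorem sum_evenRowsAbove_mul_borderedDet {s : R} (hs : s * s = 1) {lam : Fin (p + 2) → ℤ}
    (hlam : lam ∈ signedPartitionsIn (p + 2) k) (r : Fin (p + 2) → Rˣ) (q : Rˣ) :
    ∑ mu ∈ evenRowsAbove k lam, ↑(q ^ ∑ j, -(2 * mu j)) *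
        borderedDet (fun j i => partialSum s (r i) q (mu j + weylVector j))
          (fun i => twoTerm s (r i) (lam (Fin.last (p + 1)))) =
      ↑(q ^ ∑ j : Fin (p + 1), (weylVector j - lam j.castSucc)) * alternant s lam r := by
  obtain ⟨-, hparity, hdecr⟩ := mem_signedPartitionsIn.1 hlam
  have lam_abs := abs_castSucc_of_mem_signedPartitionsIn hlam
  let v (j : Fin (p + 2)) : Fin (p + 2) → R := fun i =>
    ↑(q ^ (-(|lam j| + weylVector j))) * twoTerm s (r i) (|lam j| + weylVector j)
  obtain ⟨c, hc⟩ : ∃ c : R, v (Fin.last (p + 1)) =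
      c • fun i => twoTerm s (r i) (lam (Fin.last (p + 1))) := by
    obtain ⟨c, hc⟩ := exists_forall_twoTerm_abs_eq hs (lam (Fin.last (p + 1)))
    refine ⟨↑(q ^ (-|lam (Fin.last (p + 1))|)) * c, funext fun i => ?_⟩
    simp only [v, weylVector_last, add_zero, hc, Pi.smul_apply, smul_eq_mul, mul_assoc]
  have row_sum (j : Fin (p + 1)) : ∑ t ∈ parityIcc k |lam j.succ| (lam j.castSucc),
      (↑(q ^ (-(2 * t))) : R) • (fun i => partialSum s (r i) q (t + weylVector j)) =
        (↑(q ^ (2 * weylVector j + 2)) : R) • (v j.castSucc - v j.succ) := by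
    have hle : |lam j.succ| ≤ lam j.castSucc + 2 := by linarith [hdecr _ _ j.castSucc_lt_succ]
    have telescope (i : Fin (p + 2)) := sum_zpow_neg_mul_partialSum s (r i) q
      (even_abs_sub (hparity j.succ)) (hparity j.castSucc) hle (weylVector j)
    ext i
    simpa only [v, lam_abs, weylVector_castSucc, weylVector_succ, Finset.sum_apply, Pi.smul_apply,
      Pi.sub_apply, smul_eq_mul, ← add_assoc] using telescope i
  have hv (j : Fin (p + 1)) : (↑(q ^ (2 * weylVector j + 2)) : R) • v j.castSucc =
      (↑(q ^ (weylVector j - lam j.castSucc)) : R) • fun i =>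
        twoTerm s (r i) (lam j.castSucc + weylVector j.castSucc) := by
    have hexp : weylVector j - lam j.castSucc =
        2 * weylVector j + 2 - (lam j.castSucc + weylVector j.castSucc) := by
      rw [weylVector_castSucc]
      ring
    simp only [v, lam_abs, hexp, smul_zpow_neg_mul_twoTerm]
  calc
    _ = borderedDet (fun j => (↑(q ^ (2 * weylVector j + 2)) : R) • (v j.castSucc - v j.succ))
        (fun i => twoTerm s (r i) (lam (Fin.last (p + 1)))) := by
      simp only [← row_sum, MultilinearMap.map_sum_finset, LinearMap.sum_apply,
        MultilinearMap.map_smul_univ, prod_val_zpow, evenRowsAbove, LinearMap.smul_apply,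
        smul_eq_mul]
    _ = borderedDet (fun j => (↑(q ^ (2 * weylVector j + 2)) : R) • v j.castSucc)
        (fun i => twoTerm s (r i) (lam (Fin.last (p + 1)))) := by
      simp only [MultilinearMap.map_smul_univ, LinearMap.smul_apply, borderedDet_sub_succ hc]
    _ = _ := by
      simp only [hv, MultilinearMap.map_smul_univ, prod_val_zpow, LinearMap.smul_apply, smul_eq_mul,
        borderedDet_apply, alternant]
      refine congrArg (fun A : Fin (p + 2) → Fin (p + 2) → R => _ * det (of A)) (funext fun j => ?_)
      cases j using Fin.lastCases <;> simp [weylVector_last]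

theorem sum_branch_mul_alternant {s : R} (hs : s * s = 1) {lam : Fin (p + 2) → ℤ}
    (hlam : lam ∈ signedPartitionsIn (p + 2) k) (w : Fin (p + 1) → Rˣ) (q : Rˣ) :
    (∑ nu ∈ signedPartitionsIn (p + 1) k, branch k lam nu q * alternant s nu w) *
      ∏ i, (trace (w i) - trace q) = alternant s lam (Fin.snoc w q : Fin (p + 2) → Rˣ) := by
  let L : ℤ := ∑ i : Fin (p + 1), lam i.castSucc
  let N (nu : Fin (p + 1) → ℤ) : ℤ :=
    ∑ j : Fin p, nu j.castSucc + |nu (Fin.last p) + lam (Fin.last (p + 1))|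
  let M (mu : Fin (p + 1) → ℤ) : ℤ := ∑ j, -(2 * mu j)
  let W : ℤ := ∑ j : Fin (p + 1), weylVector j
  have sum_oddRowsAbove {mu : Fin (p + 1) → ℤ} (hmu : mu ∈ evenRowsAbove k lam) := by
    rw [mem_evenRowsAbove] at hmu
    have mu_succ_le (j : Fin p) : mu j.succ ≤ mu j.castSucc :=
      (hmu j.succ).1.2.trans ((le_abs_self _).trans (by simpa using (hmu j.castSucc).1.1))
    exact sum_oddRowsAbove_mul_alternant hs (fun j => (hmu j).2) mu_succ_le
      ((mem_signedPartitionsIn.1 hlam).2.1 (Fin.last (p + 1))) (hmu (Fin.last p)).1.1 w q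
  calc
    _ = ∑ nu ∈ signedPartitionsIn (p + 1) k, ∑ mu ∈ interlacers k |lam| (Fin.cons (k : ℤ) |nu|),
        ↑(q ^ (L + M mu)) * (↑(q ^ N nu) * (alternant s nu w * ∏ i, (trace (w i) - trace q))) := by
      have hexp (nu mu) : L + N nu - 2 * ∑ j, mu j = L + M mu + N nu := by
        simp only [M, Finset.sum_neg_distrib, ← Finset.mul_sum]
        ring
      rw [Finset.sum_mul]
      refine Finset.sum_congr rfl fun nu hnu => ?_
      simp only [branch_eq_sum_abs_add hlam hnu, ← val_zpow_add, ← mul_assoc, ← hexp,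
        Finset.sum_mul, L, N]
    _ = ∑ mu ∈ evenRowsAbove k lam, ↑(q ^ (L + M mu)) * ∑ nu ∈ oddRowsAbove k mu,
        ↑(q ^ N nu) * (alternant s nu w * ∏ i, (trace (w i) - trace q)) := by
      simp only [Finset.mul_sum]
      exact Finset.sum_comm' fun nu mu => mem_signedPartitionsIn_and_mem_interlacers_iff hlam
    _ = ↑(q ^ L) * (↑(q ^ (-W)) * (↑(q ^ ∑ j : Fin (p + 1), (weylVector j - lam j.castSucc)) *
        alternant s lam (Fin.snoc w q : Fin (p + 2) → Rˣ))) := by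
      rw [← sum_evenRowsAbove_mul_borderedDet hs hlam, Finset.mul_sum, Finset.mul_sum]
      refine Finset.sum_congr rfl fun mu hmu => ?_
      simp only [N, M, W, sum_oddRowsAbove hmu]
      rw [val_zpow_add]
      ring
    _ = _ := by
      rw [Finset.sum_sub_distrib, ← mul_assoc, ← mul_assoc, ← val_zpow_add, ← val_zpow_add,
        ← sub_eq_add_neg, sub_add_sub_cancel, sub_self, zpow_zero, Units.val_one, one_mul]

end Alternants

section WeylFormula

variable {R : Type*} [CommRing R] {k n : ℕ}

open Matrix

/-- The product of the `trace (r i) - trace (r j)` over `i < j`: the denominator of the Weyl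
character formula for `SO(2n)`. -/
def weylDenominator (r : Fin n → Rˣ) : R :=
  det (vandermonde fun i => -trace (r i))

theorem weylDenominator_snoc (w : Fin n → Rˣ) (q : Rˣ) :
    weylDenominator (Fin.snoc w q : Fin (n + 1) → Rˣ) =
      weylDenominator w * ∏ i, (trace (w i) - trace q) := by
  have Ioi_castSucc (i : Fin n) :
      Finset.Ioi i.castSucc = insert (Fin.last n) ((Finset.Ioi i).map Fin.castSuccEmb) := by
    ext j
    cases j using Fin.lastCases <;> simp [Fin.castSucc_lt_last, Fin.le_last]
  have Ioi_last : Finset.Ioi (Fin.last n) = ∅ := Finset.Ioi_top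
  have last_notMem (i : Fin n) : Fin.last n ∉ (Finset.Ioi i).map Fin.castSuccEmb := by simp
  simp only [weylDenominator, det_vandermonde, Fin.prod_univ_castSucc, Ioi_castSucc, Ioi_last,
    Finset.prod_insert (last_notMem _), Finset.prod_map, Finset.prod_empty, Finset.prod_mul_distrib,
    Fin.snoc_castSucc, Fin.snoc_last, Fin.castSuccEmb_apply, mul_one, neg_sub_neg]
  exact mul_comm _ _

theorem alternant_one (s : R) (lam : Fin 1 → ℤ) (r : Fin 1 → Rˣ) :
    alternant s lam r = twoTerm s (r 0) (lam 0) := by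
  rw [alternant, det_fin_one, of_apply, ← Fin.last_zero, weylVector_last, add_zero]

theorem soEven_mul_weylDenominator {lam : Fin n → ℤ} (hlam : lam ∈ signedPartitionsIn n k)
    (r : Fin n → Rˣ) :
    soEven lam r * (2 * weylDenominator r) = alternant 1 lam r + alternant (-1) lam r := by
  induction n with
  | zero => norm_num [soEven_zero, weylDenominator, alternant, det_isEmpty]
  | succ n ih =>
    obtain ⟨w, q, rfl⟩ : ∃ (w : Fin n → Rˣ) (q : Rˣ), r = (Fin.snoc w q : Fin (n + 1) → Rˣ) :=
      ⟨Fin.init r, r (Fin.last n), (Fin.snoc_init_self r).symm⟩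
    rw [soEven_snoc hlam, weylDenominator_snoc]
    cases n with
    | zero =>
      rw [signedPartitionsIn_zero, Fintype.sum_unique, branch_zero, soEven_zero, alternant_one,
        alternant_one, ← Fin.last_zero, Fin.snoc_last, weylDenominator, det_isEmpty, twoTerm,
        twoTerm, Finset.univ_eq_empty, Finset.prod_empty]
      ring
    | succ p =>
      rw [← sum_branch_mul_alternant (one_mul 1) hlam,
        ← sum_branch_mul_alternant (neg_mul_neg 1 1 |>.trans (one_mul 1)) hlam, ← add_mul,
        ← Finset.sum_add_distrib, ← mul_assoc, ← mul_assoc, Finset.sum_mul, Finset.sum_mul]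
      congr 1
      refine Finset.sum_congr rfl fun nu hnu => ?_
      rw [← mul_add, ← ih hnu]
      ring

theorem alternant_comp_perm (s : R) (lam : Fin n → ℤ) (r : Fin n → Rˣ) (σ : Equiv.Perm (Fin n)) :
    alternant s lam (r ∘ σ) = (Equiv.Perm.sign σ : ℤ) * alternant s lam r :=
  det_permute' σ (of fun j i : Fin n => twoTerm s (r i) (lam j + weylVector j))

theorem weylDenominator_comp_perm (r : Fin n → Rˣ) (σ : Equiv.Perm (Fin n)) :
    weylDenominator (r ∘ σ) = (Equiv.Perm.sign σ : ℤ) * weylDenominator r :=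
  det_permute σ (vandermonde fun i => -trace (r i))

theorem soEven_comp_perm_of_trace_injective [IsDomain R] (htwo : (2 : R) ≠ 0) {lam : Fin n → ℤ}
    (hlam : lam ∈ signedPartitionsIn n k) {r : Fin n → Rˣ}
    (hr : Function.Injective fun i => trace (r i)) (σ : Equiv.Perm (Fin n)) :
    soEven lam (r ∘ σ) = soEven lam r := by
  have denominator_ne_zero : weylDenominator (r ∘ σ) ≠ 0 :=
    det_vandermonde_ne_zero_iff.2 fun i j hij => σ.injective (hr (neg_injective hij))
  refine mul_right_cancel₀ (mul_ne_zero htwo denominator_ne_zero) ?_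
  rw [soEven_mul_weylDenominator hlam, alternant_comp_perm, alternant_comp_perm, ← mul_add,
    ← soEven_mul_weylDenominator hlam, weylDenominator_comp_perm]
  ring

end WeylFormula

section Symmetry

variable {R : Type*} [CommRing R] {k n : ℕ}

theorem map_soEven {S : Type*} [CommRing S] (f : S →+* R) (lam : Fin n → ℤ) (r : Fin n → Sˣ) :
    f (soEven lam r) = soEven lam fun i => Units.map (f : S →* R) (r i) := by
  simp only [soEven, patternWeight, map_sum, ← map_zpow, ← map_prod, Units.coe_map,
    MonoidHom.coe_coe]

/-- The variable with index `i` in the ring of Laurent polynomials in `n` variables, encoded as the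
group algebra of `ℤ ^ n`. -/
noncomputable def laurentX (i : Fin n) : (AddMonoidAlgebra ℤ (Fin n → ℤ))ˣ :=
  Units.map (AddMonoidAlgebra.of ℤ (Fin n → ℤ))
    (toUnits (Multiplicative.ofAdd (Pi.single i (1 : ℤ))))

theorem val_laurentX_zpow (i : Fin n) (a : ℤ) :
    (↑(laurentX i ^ a) : AddMonoidAlgebra ℤ (Fin n → ℤ)) =
      AddMonoidAlgebra.single (Pi.single i a) 1 := by
  rw [laurentX, ← map_zpow, ← map_zpow, Units.coe_map, ← ofAdd_zsmul]
  simp [← Pi.single_smul]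

theorem exists_map_laurentX_eq (r : Fin n → Rˣ) :
    ∃ f : AddMonoidAlgebra ℤ (Fin n → ℤ) →+* R,
      (fun i => Units.map (f : AddMonoidAlgebra ℤ (Fin n → ℤ) →* R) (laurentX i)) = r := by
  let monomial : Multiplicative (Fin n → ℤ) →* R :=
    { toFun a := ↑(∏ i, r i ^ a.toAdd i)
      map_one' := by simp
      map_mul' a b := by simp [zpow_add, Finset.prod_mul_distrib] }
  refine ⟨(AddMonoidAlgebra.lift ℤ R (Fin n → ℤ) monomial : _ →+* R),
    funext fun i => Units.ext ?_⟩
  refine (AddMonoidAlgebra.lift_of monomial _).trans ?_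
  simp [monomial, Pi.single_apply, apply_ite Units.val]

theorem trace_laurentX_injective : Function.Injective fun i : Fin n => trace (laurentX i) := by
  intro i j hij
  by_contra hne
  have hsingle (a : ℤ) : (Pi.single j a : Fin n → ℤ) ≠ Pi.single i 2 := fun h => by
    simpa [hne] using congrFun h i
  simp only [trace, val_laurentX_zpow] at hij
  have := congrArg (fun x => x.coeff (Pi.single i 2)) hij
  simp [hsingle] at this

theorem soEven_comp_perm {lam : Fin n → ℤ} (hlam : lam ∈ signedPartitionsIn n k) (r : Fin n → Rˣ)
    (σ : Equiv.Perm (Fin n)) : soEven lam (r ∘ σ) = soEven lam r := by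
  obtain ⟨f, rfl⟩ := exists_map_laurentX_eq r
  have two_ne_zero : (2 : AddMonoidAlgebra ℤ (Fin n → ℤ)) ≠ 0 := fun h => by
    simpa using congrArg (fun x => x.coeff 0) h
  have hsymm : soEven lam (laurentX ∘ σ) = soEven lam laurentX :=
    soEven_comp_perm_of_trace_injective two_ne_zero hlam trace_laurentX_injective σ
  exact (map_soEven f lam _).symm.trans ((congrArg f hsymm).trans (map_soEven f lam _))

end Symmetry

section Rectangles

variable {n m k : ℕ} {R : Type*} [CommRing R]

theorem cons_mem_signedPartitionsIn {lam : Fin n → ℤ} :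
    (Fin.cons (k : ℤ) lam : Fin (n + 1) → ℤ) ∈ signedPartitionsIn (n + 1) k ↔
      lam ∈ signedPartitionsIn n k := by
  simp only [mem_signedPartitionsIn, Fin.forall_fin_succ, Fin.cons_zero, Fin.cons_succ,
    Nat.abs_cast, sub_self, Fin.succ_lt_succ_iff, Fin.succ_pos, Fin.not_lt_zero]
  grind

theorem rectAppend_self (lam : Fin m → ℤ) : rectAppend k m lam = lam := by
  funext i
  simp [rectAppend]

theorem rectAppend_succ (h : m ≤ n) (lam : Fin m → ℤ) :
    rectAppend k (n + 1) lam = Fin.cons (k : ℤ) (rectAppend k n lam) := by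
  funext i
  cases i using Fin.cases <;>
    grind [rectAppend, Fin.cons_zero, Fin.cons_succ]

theorem rectAppend_mem_signedPartitionsIn (h : m ≤ n) {lam : Fin m → ℤ}
    (hlam : lam ∈ signedPartitionsIn m k) : rectAppend k n lam ∈ signedPartitionsIn n k := by
  induction n, h using Nat.le_induction with
  | base => rwa [rectAppend_self]
  | succ n h ih => rwa [rectAppend_succ h, cons_mem_signedPartitionsIn]

theorem rectAppend_fin_zero (lam : Fin 0 → ℤ) : rectAppend k n lam = rect k n := by
  funext i
  grind [rectAppend, rect]

theorem sum_signedPartitionsIn_cons {M : Type*} [AddCommMonoid M] (f : (Fin (n + 1) → ℤ) → M)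
    (hf : ∀ nu ∈ signedPartitionsIn (n + 1) k, nu 0 ≠ k → f nu = 0) :
    ∑ nu ∈ signedPartitionsIn (n + 1) k, f nu =
      ∑ nu ∈ signedPartitionsIn n k, f (Fin.cons (k : ℤ) nu) := by
  symm
  refine Finset.sum_of_injOn (fun nu => (Fin.cons (k : ℤ) nu : Fin (n + 1) → ℤ))
    (Fin.cons_right_injective (α := fun _ => ℤ) _).injOn
    (fun nu hnu => cons_mem_signedPartitionsIn.2 hnu) (fun nu hnu hrange => ?_) fun _ _ => rfl
  refine hf nu hnu fun hfirst => hrange ⟨Fin.tail nu, ?_, ?_⟩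
  · rwa [Finset.mem_coe, ← cons_mem_signedPartitionsIn, ← hfirst, Fin.cons_self_tail]
  · exact hfirst ▸ Fin.cons_self_tail nu

theorem sum_branch_rectAppend {al : Fin m → ℤ} (hal : al ∈ signedPartitionsIn m k) (q : Rˣ)
    (h : m + 1 ≤ n) (g : (Fin n → ℤ) → R) :
    ∑ nu ∈ signedPartitionsIn n k, branch k (rectAppend k (n + 1) al) nu q * g nu =
      ∑ be ∈ signedPartitionsIn (m + 1) k, branch k be al q * g (rectAppend k n be) := by
  induction n, h using Nat.le_induction with
  | base =>
    refine Finset.sum_congr rfl fun be hbe => ?_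
    rw [rectAppend_succ (Nat.le_succ m), rectAppend_succ le_rfl, rectAppend_self, rectAppend_self,
      branch_cons_cons_comm ((mem_signedPartitionsIn.1 hbe).1 0)]
  | succ n h ih =>
    obtain ⟨n, rfl⟩ := Nat.exists_eq_add_of_le' (Nat.one_le_of_lt h)
    rw [sum_signedPartitionsIn_cons]
    · refine .trans (Finset.sum_congr rfl fun nu _ => ?_)
        ((ih fun nu => g (Fin.cons (k : ℤ) nu)).trans (Finset.sum_congr rfl fun be _ => ?_))
      · have hmem : rectAppend k (n + 2) al ∈ signedPartitionsIn (n + 2) k :=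
          rectAppend_mem_signedPartitionsIn (by omega) hal
        rw [rectAppend_succ (by omega) al,
          branch_cons_cons ((mem_signedPartitionsIn.1 hmem).1 0)]
      · rw [rectAppend_succ h]
    · intro nu hnu hfirst
      obtain ⟨hbound, -, hdecr⟩ := mem_signedPartitionsIn.1 hnu
      have nu_lt : |nu 0| < k := by
        have := hdecr 0 1 (by simp)
        grind
      rw [rectAppend_succ (by omega), rectAppend_succ (by omega), rectAppend_succ (by omega),
        branch_cons_cons_cons_eq_zero nu_lt, zero_mul]

theorem sum_soEven_rectAppend_succ (h : m + 1 ≤ n) (r : Fin n → Rˣ) (q : Rˣ) (s : Fin m → Rˣ) :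
    ∑ al ∈ signedPartitionsIn m k,
        soEven (rectAppend k (n + 1) al) (Fin.snoc r q : Fin (n + 1) → Rˣ) * soEven al s =
      ∑ be ∈ signedPartitionsIn (m + 1) k,
        soEven (rectAppend k n be) r * soEven be (Fin.snoc s q : Fin (m + 1) → Rˣ) := by
  calc
    _ = ∑ al ∈ signedPartitionsIn m k, ∑ be ∈ signedPartitionsIn (m + 1) k,
        branch k be al q * soEven (rectAppend k n be) r * soEven al s :=
      Finset.sum_congr rfl fun al hal => by
        rw [soEven_snoc (rectAppend_mem_signedPartitionsIn (by omega) hal),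
          sum_branch_rectAppend hal q h, Finset.sum_mul]
    _ = ∑ be ∈ signedPartitionsIn (m + 1) k, ∑ al ∈ signedPartitionsIn m k,
        branch k be al q * soEven (rectAppend k n be) r * soEven al s := Finset.sum_comm
    _ = _ := Finset.sum_congr rfl fun be hbe => by
        rw [soEven_snoc hbe, Finset.mul_sum]
        exact Finset.sum_congr rfl fun al _ => by ring

theorem soEven_rect_comp_equiv (e : Fin n ≃ Fin m) (r : Fin m → Rˣ) :
    soEven (rect k n) (r ∘ e) = soEven (rect k m) r := by
  obtain rfl : n = m := by simpa using Fintype.card_congr e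
  exact soEven_comp_perm (rect_mem_signedPartitionsIn k n) r e

theorem soEven_rect_snoc_append (r : Fin n → Rˣ) (s : Fin m → Rˣ) (q : Rˣ) :
    soEven (rect k (n + m + 1)) (Fin.snoc (Fin.append r s) q : Fin (n + m + 1) → Rˣ) =
      soEven (rect k (n + 1 + m)) (Fin.append (Fin.snoc r q : Fin (n + 1) → Rˣ) s) := by
  let e : Fin (n + m + 1) ≃ Fin (n + 1 + m) :=
    finSumFinEquiv.symm.trans <|
      (finSumFinEquiv.symm.sumCongr (.refl (Fin 1))).trans <|
      (Equiv.sumAssoc _ _ _).trans <| ((Equiv.refl _).sumCongr (.sumComm _ _)).trans <|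
      (Equiv.sumAssoc _ _ _).symm.trans <|
      (finSumFinEquiv.sumCongr (.refl _)).trans finSumFinEquiv
  have snoc_eq {j : ℕ} (t : Fin j → Rˣ) : Fin.snoc t q = Fin.append t fun _ : Fin 1 => q :=
    (Fin.append_right_eq_snoc t fun _ => q).symm
  rw [← soEven_rect_comp_equiv e, snoc_eq, snoc_eq]
  congr 1
  funext i
  cases i using Fin.addCases with
  | left i => cases i using Fin.addCases <;> simp [e]
  | right i => simp [e]

theorem soEven_rect_add (h : m ≤ n) (r : Fin n → Rˣ) (s : Fin m → Rˣ) :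
    soEven (rect k (n + m)) (Fin.append r s) =
      ∑ lam ∈ signedPartitionsIn m k, soEven (rectAppend k n lam) r * soEven lam s := by
  induction m generalizing n with
  | zero =>
    have append_eq : Fin.append r s = r := funext fun i => Fin.append_left r s i
    simp [append_eq, signedPartitionsIn_zero, soEven_zero, rectAppend_fin_zero]
  | succ m ih =>
    obtain ⟨s, q, rfl⟩ : ∃ s' q, s = Fin.snoc s' q := ⟨_, _, (Fin.snoc_init_self s).symm⟩
    calc
      _ = soEven (rect k (n + 1 + m)) (Fin.append (Fin.snoc r q : Fin (n + 1) → Rˣ) s) := by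
        rw [Fin.append_snoc]
        exact soEven_rect_snoc_append r s q
      _ = ∑ lam ∈ signedPartitionsIn m k,
          soEven (rectAppend k (n + 1) lam) (Fin.snoc r q : Fin (n + 1) → Rˣ) * soEven lam s :=
        ih (by omega) _ s
      _ = _ := sum_soEven_rectAppend_succ h r q s

theorem soEven_withSign_neg_one_snoc {lam : Fin (n + 1) → ℤ}
    (hlam : lam ∈ signedPartitionsIn (n + 1) k) (r : Fin n → Rˣ) (q : Rˣ) :
    soEven (withSign (-1) lam) (Fin.snoc r q : Fin (n + 1) → Rˣ) =
      soEven lam (Fin.snoc r q⁻¹ : Fin (n + 1) → Rˣ) := by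
  rw [soEven_snoc (withSign_mem_signedPartitionsIn _ hlam), soEven_snoc hlam]
  exact Finset.sum_congr rfl fun nu hnu => by rw [branch_withSign_neg_one hlam hnu]

theorem soEven_withSign_rect_add (h : m ≤ n) (ε : ℤˣ) (hε : 0 < m ∨ ε = 1) (r : Fin n → Rˣ)
    (s : Fin m → Rˣ) :
    soEven (withSign ε (rect k (n + m))) (Fin.append r s) =
      ∑ lam ∈ signedPartitionsIn m k,
        soEven (rectAppend k n lam) r * soEven (withSign ε lam) s := by
  obtain rfl | rfl := Int.units_eq_one_or ε
  · simp only [withSign_one]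
    exact soEven_rect_add h r s
  · obtain ⟨m, rfl⟩ := Nat.exists_eq_add_of_le' (hε.resolve_right (by decide))
    obtain ⟨s, q, rfl⟩ : ∃ s' q, s = Fin.snoc s' q := ⟨_, _, (Fin.snoc_init_self s).symm⟩
    calc
      _ = soEven (rect k (n + (m + 1))) (Fin.append r (Fin.snoc s q⁻¹ : Fin (m + 1) → Rˣ)) := by
        rw [Fin.append_snoc, Fin.append_snoc]
        exact soEven_withSign_neg_one_snoc (rect_mem_signedPartitionsIn k _) _ q
      _ = ∑ lam ∈ signedPartitionsIn (m + 1) k,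
          soEven (rectAppend k n lam) r * soEven lam (Fin.snoc s q⁻¹ : Fin (m + 1) → Rˣ) :=
        soEven_rect_add h r _
      _ = _ := Finset.sum_congr rfl fun lam hlam => by rw [soEven_withSign_neg_one_snoc hlam]

theorem soOdd_rect_add (h : m ≤ n + 1) (r : Fin n → Rˣ) (s : Fin m → Rˣ) :
    soOdd (rect k (n + m)) (Fin.append r s) =
      ∑ lam ∈ signedPartitionsIn m k,
        soEven (rectAppend k (n + 1) lam) (Fin.append r fun _ : Fin 1 => 1) * soEven lam s := by
  rw [soOdd_rect, soEven_rect_snoc_append, soEven_rect_add h, Fin.append_right_eq_snoc]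

end Rectangles

end OrthogonalCharacters

theorem mainTheorem8 {R : Type*} [CommRing R] (n m k : ℕ) (r : Fin n → Rˣ) (s : Fin m → Rˣ) :
    (m ≤ n → ∀ ε : ℤˣ, (0 < m ∨ ε = 1) →
      OrthogonalCharacters.soEven
          (OrthogonalCharacters.withSign ε (OrthogonalCharacters.rect k (n + m)))
          (Fin.append r s) =
        ∑ lam ∈ OrthogonalCharacters.signedPartitionsIn m k,
          OrthogonalCharacters.soEven (OrthogonalCharacters.rectAppend k n lam) r *
            OrthogonalCharacters.soEven (OrthogonalCharacters.withSign ε lam) s) ∧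
    (m ≤ n + 1 →
      OrthogonalCharacters.soOdd (OrthogonalCharacters.rect k (n + m)) (Fin.append r s) =
        ∑ lam ∈ OrthogonalCharacters.signedPartitionsIn m k,
          OrthogonalCharacters.soEven (OrthogonalCharacters.rectAppend k (n + 1) lam)
              (Fin.append r (fun _ : Fin 1 => 1)) *
            OrthogonalCharacters.soEven lam s) :=
  ⟨fun h ε hε => OrthogonalCharacters.soEven_withSign_rect_add h ε hε r s,
    fun h => OrthogonalCharacters.soOdd_rect_add h r s⟩
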